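/- Let $\mathcal D$ be any set of letters (finite or infinite). **Programs.** A first-order simple for-program uses finitely many letter constants $A\subseteq\mathcal D$. It defines a function $\mathcal D^*\to\mathcal D^*$ and is built from skip, $b:=\mathtt{True}$, $\mathtt{print}(a)$ with $a\in A$, $\mathtt{print}(\mathsf{label}(i))$, $\mathtt{if}$/$\mathtt{then}$/$\mathtt{else}$, sequencing, and loops over the positions of the input word in increasing or decreasing order. Boolean variables are declared (with value false) only at the top of the program or at the beginning of a loop body. Conditions are boolean combinations of boolean variables, comparisons ($=,\neq,<,\le,>,\ge$) of position variables, and tests $\mathsf{label}(i)=a$ with $a\in A$. **Interpretations.** A first-order string-to-string interpretation consists of a finite set $A\subseteq\mathcal D$, a finite set $T$ of tags, arities $\mathsf{ar}(t)\in\mathbb N$, outputs $\mathsf{out}(t)\in A+\{1,\dots,\mathsf{ar}(t)\}$, domain formulas $\varphi^t_{\mathsf{dom}}(\bar x)$ and order formulas $\varphi_\le^{t,t'}(\bar x,\bar y)$; these are first-order formulas over the positions of a word, with predicates $=$, $<$, and $x=_L a$ for $a\in A$. On a word $w$, its elements are the pairs $t(\bar p)$ of a tag and a tuple of $\mathsf{ar}(t)$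 positions such that $w\models\varphi^t_{\mathsf{dom}}(\bar p)$. They are sorted by the order formulas, and each contributes the letter $\mathsf{out}(t)$, or the letter of $w$ at position $p_{\mathsf{out}(t)}$. The output is empty if the order formulas do not define a total order on the elements. **Program formulas.** In a scope with finitely many position and boolean variables, a program formula is a first-order formula over two sorts, positions and booleans, whose free variables are position variables, input booleans $b^{\mathsf{in}}$ and output booleans $b^{\mathsf{out}}$. Let $B^{\mathsf{in}}(\Phi)$, $B^{\mathsf{out}}(\Phi)$ be the sets of variables $b$ such that $b^{\mathsf{in}}$, respectively $b^{\mathsf{out}}$, occurs in $\Phi$. The quantifier rank $\mathrm{qr}$ counts quantifiers of both sorts. For a word $w$ and values of the position variables, $\Phi$ *describes* a map $F$ on valuations of the boolean variables if $F$ changes no variable outside $B^{\mathsf{out}}(\Phi)$ and, for input values $\sigma$ and output values $\tau$, $\Phi$ holds if and only if $\tau(b)=F(\sigma)(b)$ for every $b\in B^{\mathsf{out}}(\Phi)$. The following operations are used. * Branching: $(\varphi\wedge\Phi_1\wedge\bigwedge_b (b^{\mathsf{in}}\Leftrightarrow b^{\mathsf{out}}))\vee(\neg\varphi\wedge\Phi_2\wedge\bigwedge_b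 (b^{\mathsf{in}}\Leftrightarrow b^{\mathsf{out}}))$, where in each branch $b$ ranges over the output variables of the other branch that are missing in this one. * Sequencing $\Phi_1;\Phi_2$: existentially quantify the intermediate values of the variables in $S=B^{\mathsf{out}}(\Phi_1)\cap(B^{\mathsf{in}}(\Phi_2)\cup B^{\mathsf{out}}(\Phi_2))$, substitute them for the outputs in $\Phi_1$ and for the inputs in $\Phi_2$, take the conjunction, and copy the intermediate values of $S\setminus B^{\mathsf{out}}(\Phi_2)$ to the outputs. * Accelerated iteration $\Phi^*$ of $\Phi$ over a position variable, forward or backward. Let $B=B^{\mathsf{out}}(\Phi)$ and $c=|B|$. If $w$ is empty, $\Phi^*$ says $b^{\mathsf{in}}\Leftrightarrow b^{\mathsf{out}}$ for all $b\in B$. Otherwise it says that there are positions $p_1,\dots,p_c$, weakly ordered in the direction of the loop, and vectors $\vec b_1,\dots,\vec b_c\in\mathbb B^B$ such that, with $\vec b_0$ the vector of the inputs: for every $1\le i\le c$, either $i>1$, $p_i=p_{i-1}$ and $\vec b_i=\vec b_{i-1}$, or $\Phi(p_i;\vec b_{i-1};\vec b_i)$ and ($i=1$ or $p_i\ne p_{i-1}$);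 for every $0\le i\le c$ and every position $p$ strictly between $p_i$ and $p_{i+1}$ in the direction of the loop, $\Phi(p;\vec b_i;\vec b_i)$ (here $p_0$ and $p_{c+1}$ lie before and after all positions); and $\vec b_c$ is the vector of the outputs. Inputs outside $B$ are left unchanged throughout. **Theorem.** 1. Every first-order simple for-program $P$ is transformed into a first-order string-to-string interpretation $I_P$ with the same letter constants $A$ as follows. The tags are the occurrences of print statements in $P$. The arity of a tag is the number of position variables in its scope, and its output is the printed constant or the index of the printed position variable. The order formula of two print statements compares their shared position variables lexicographically, in the directions of the loops, and breaks ties by the order in the source code. The domain formula of a print statement is built from program formulas: it is the conjunction of the conditions, or their negations, on the path to the statement, evaluated at the boolean values that are described by the program formulas of the code executed before; for an enclosing loop at position $i$, this code is described by the accelerated iteration of the branching "if $j$ is visited strictly before $i$ then $\Phi(j)$ else skip", where $\Phi$ is the program formula of the loop body. The boolean sort is finally eliminated by replacing each boolean quantifier by a disjunction or conjunction over the two truth values. Then for every $w\in\mathcal D^*$ the order formulas define a total order on the elements of $I_P$ on $w$, and $I_P(w)=P(w)$. Moreover, the order formulas are quantifier-free. 2. Let $\Phi_s$ be the program formula of a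 statement $s$: $\top$ for skip and print, $b^{\mathsf{out}}$ for $b:=\mathtt{True}$, branching for $\mathtt{if}$, sequencing for $;$, and for a loop the accelerated iteration of the program formula of its body, in which the inputs of the variables declared in the loop are set to false and their outputs are existentially quantified. Then, for every word and all values of the position variables, $\Phi_s$ describes the effect of $s$ on the boolean variables. 3. If $\Phi_1$ and $\Phi_2$ describe $F_1$ and $F_2$, and $\varphi$ has no output variables, then branching describes $\sigma\mapsto F_1(\sigma)$ if $\varphi$ holds at $\sigma$, and $\sigma\mapsto F_2(\sigma)$ otherwise. 4. If $\Phi_1$ and $\Phi_2$ describe $F_1$ and $F_2$, then $\Phi_1;\Phi_2$ describes $F_2\circ F_1$. For all program formulas $\Phi_1,\Phi_2$, $$\mathrm{qr}(\Phi_1;\Phi_2)\le\max(\mathrm{qr}(\Phi_1),\mathrm{qr}(\Phi_2))+|B^{\mathsf{out}}(\Phi_1)\cap(B^{\mathsf{in}}(\Phi_2)\cup B^{\mathsf{out}}(\Phi_2))|.$$ 5. If, for every position $p$ of $w$, $\Phi(p)$ describes a map $F_p$, and no $F_p$ changes a boolean from true to false, then $\Phi^*$ describes the composition of the maps $F_p$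 over all positions $p$ of $w$, in the order of the loop. For every program formula $\Phi$, $$\mathrm{qr}(\Phi^*)\le\mathrm{qr}(\Phi)+|B^{\mathsf{out}}(\Phi)|^2+|B^{\mathsf{out}}(\Phi)|+1.$$ -/

import Mathlib

namespace ForProg

universe u

section Basics

/-- Direction of a loop: `for i in input` or `for i in reversed(input)`. -/
inductive Dir where
  | fwd
  | bwd

/-- The positions of the word `w`. -/
abbrev Pos {D : Type u} (w : List D) : Type := Fin w.length

/-- The positions of `w` in the order in which a loop visits them. -/
def Dir.positions {D : Type u} (w : List D) : Dir → List (Pos w)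
  | .fwd => List.finRange w.length
  | .bwd => (List.finRange w.length).reverse

/-- Append one value at the end of a tuple. -/
def push {α : Type*} {k : ℕ} (f : Fin k → α) (a : α) : Fin (k + 1) → α :=
  Fin.snoc (α := fun _ => α) f a

/-- The number of elements of `S` that are smaller than `b`. -/
def rank {n : ℕ} (S : Finset (Fin n)) (b : Fin n) : ℕ := (S.filter (· < b)).card

theorem rank_lt {n : ℕ} {S : Finset (Fin n)} {b : Fin n} (h : b ∈ S) : rank S b < S.card := by
  apply Finset.card_lt_card
  refine ⟨Finset.filter_subset _ _, fun h' => ?_⟩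
  have := (Finset.mem_filter.1 (h' h)).2
  exact lt_irrefl _ this

end Basics

/-! ## First-order simple for-programs

Variables are represented by their de Bruijn levels: in a scope with `k` position variables and
`n` boolean variables, they are the elements of `Fin k` and of `Fin n`, the outermost
variable having number `0`. Letter constants come from a finite set `A` of letters. -/

inductive BinOp where
  | and
  | or
  | imp
  | iff

def BinOp.eval : BinOp → Bool → Bool → Bool
  | .and, a, b => a && b
  | .or, a, b => a || b
  | .imp, a, b => !a || b
  | .iff, a, b => a == b

inductive CmpOp where
  | eq
  | ne
  | lt
  | le
  | gt
  | ge

def CmpOp.eval {N : ℕ} : CmpOp → Fin N → Fin N → Bool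
  | .eq, i, j => decide (i = j)
  | .ne, i, j => decide (i ≠ j)
  | .lt, i, j => decide (i < j)
  | .le, i, j => decide (i ≤ j)
  | .gt, i, j => decide (j < i)
  | .ge, i, j => decide (j ≤ i)

/-- Conditions of `if` statements. -/
inductive BExpr {D : Type u} (A : Finset D) (k n : ℕ) : Type u where
  | const (c : Bool)
  | not (e : BExpr A k n)
  | bin (op : BinOp) (e₁ e₂ : BExpr A k n)
  | var (b : Fin n)
  | cmp (op : CmpOp) (i j : Fin k)
  /-- the test `label(i) == a` -/
  | labelEq (i : Fin k) (a : A)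

/-- Statements in a scope with `k` position variables and `n` boolean variables. -/
inductive Stmt {D : Type u} (A : Finset D) : ℕ → ℕ → Type u where
  | skip {k n : ℕ} : Stmt A k n
  /-- `b := True` -/
  | setTrue {k n : ℕ} (b : Fin n) : Stmt A k n
  /-- `print(a)` -/
  | printConst {k n : ℕ} (a : A) : Stmt A k n
  /-- `print(label(i))` -/
  | printLabel {k n : ℕ} (i : Fin k) : Stmt A k n
  | ite {k n : ℕ} (e : BExpr A k n) (s₁ s₂ : Stmt A k n) : Stmt A k n
  | seq {k n : ℕ} (s₁ s₂ : Stmt A k n) : Stmt A k n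
  /-- A loop over the positions of the input; its body starts with the declaration of `m` new
  boolean variables, initialised to `False`. -/
  | loop {k n : ℕ} (d : Dir) (m : ℕ) (body : Stmt A (k + 1) (n + m)) : Stmt A k n

/-- A first-order simple for-program: its letter constants, the number of the boolean variables
declared at the top (and initialised to `False`), and its body. -/
structure Program (D : Type u) where
  A : Finset D
  n : ℕ
  body : Stmt A 0 n

section Semantics

variable {D : Type u} [DecidableEq D] {A : Finset D}

def BExpr.eval {k n : ℕ} (w : List D) (ρ : Fin k → Pos w) (σ : Fin n → Bool) :
    BExpr A k n → Bool
  | .const c => c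
  | .not e => !(e.eval w ρ σ)
  | .bin op e₁ e₂ => op.eval (e₁.eval w ρ σ) (e₂.eval w ρ σ)
  | .var b => σ b
  | .cmp op i j => op.eval (ρ i) (ρ j)
  | .labelEq i a => decide (w.get (ρ i) = (a : D))

/-- The result of a statement: the new values of the boolean variables, and the printed word. -/
def Stmt.exec (w : List D) : {k n : ℕ} → Stmt A k n → (Fin k → Pos w) → (Fin n → Bool) →
    (Fin n → Bool) × List D
  | _, _, .skip, _, σ => (σ, [])
  | _, _, .setTrue b, _, σ => (Function.update σ b true, [])
  | _, _, .printConst a, _, σ => (σ, [(a : D)])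
  | _, _, .printLabel i, ρ, σ => (σ, [w.get (ρ i)])
  | _, _, .ite e s₁ s₂, ρ, σ => if e.eval w ρ σ then s₁.exec w ρ σ else s₂.exec w ρ σ
  | _, _, .seq s₁ s₂, ρ, σ =>
      let r₁ := s₁.exec w ρ σ
      let r₂ := s₂.exec w ρ r₁.1
      (r₂.1, r₁.2 ++ r₂.2)
  | _, _, .loop d m body, ρ, σ =>
      (d.positions w).foldl
        (fun st p =>
          let r := body.exec w (push ρ p) (Fin.append st.1 (fun _ : Fin m => false))
          (fun b => r.1 (Fin.castAdd m b), st.2 ++ r.2))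
        (σ, [])

/-- The function from words to words defined by a program. -/
def Program.eval (P : Program D) (w : List D) : List D :=
  (P.body.exec w Fin.elim0 (fun _ => false)).2

end Semantics

/-! ## First-order logic on words and first-order string-to-string interpretations -/

inductive WordRel {D : Type u} (A : Finset D) : ℕ → Type u where
  | lt : WordRel A 2
  | label (a : A) : WordRel A 1

/-- The language of first-order logic on words, with letter constants from `A`: the symbol `<` and
a unary predicate `· =_L a` for every `a ∈ A`. -/
def wordLang {D : Type u} (A : Finset D) : FirstOrder.Language.{0, u} where
  Functions := fun _ => Empty
  Relations := WordRel A

/-- First-order formulas on words, with letter constants from `A`, and `k` free variables. -/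
abbrev WordFormula {D : Type u} (A : Finset D) (k : ℕ) : Type u :=
  (wordLang A).BoundedFormula Empty k

/-- The positions of `w` as a structure. -/
@[reducible]
def wordStructure {D : Type u} (A : Finset D) (w : List D) : (wordLang A).Structure (Pos w) where
  funMap := fun f _ => Empty.elim f
  RelMap := fun R => match R with
    | .lt => fun x => x 0 < x 1
    | .label a => fun x => w.get (x 0) = (a : D)

/-- `φ(x)` holds in `w`. -/
def WordFormula.Holds {D : Type u} {A : Finset D} {k : ℕ} (φ : WordFormula A k) (w : List D)
    (x : Fin k → Pos w) : Prop :=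
  @FirstOrder.Language.BoundedFormula.Realize (wordLang A) (Pos w) (wordStructure A w) Empty k φ
    Empty.elim x

section WordFormulas

variable {D : Type u} {A : Finset D} {k : ℕ}

/-- The variable `i` as a term. -/
def WordFormula.tm (i : Fin k) : (wordLang A).Term (Empty ⊕ Fin k) :=
  FirstOrder.Language.Term.var (Sum.inr i)

/-- `i = j` -/
def WordFormula.eqV (i j : Fin k) : WordFormula A k :=
  FirstOrder.Language.Term.bdEqual (WordFormula.tm i) (WordFormula.tm j)

/-- `i < j` -/
def WordFormula.ltV (i j : Fin k) : WordFormula A k :=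
  FirstOrder.Language.BoundedFormula.rel (L := wordLang A) (l := 2) (WordRel.lt : WordRel A 2)
    ![WordFormula.tm i, WordFormula.tm j]

/-- `i =_L a` -/
def WordFormula.labelV (i : Fin k) (a : A) : WordFormula A k :=
  FirstOrder.Language.BoundedFormula.rel (L := wordLang A) (l := 1) (WordRel.label a : WordRel A 1)
    ![WordFormula.tm i]

/-- `i` is visited strictly before `j`, or `i = j` and `φ`. -/
def WordFormula.lexV (d : Dir) (i j : Fin k) (φ : WordFormula A k) : WordFormula A k :=
  (match d with
    | .fwd => WordFormula.ltV i j
    | .bwd => WordFormula.ltV j i) ⊔ (WordFormula.eqV i j ⊓ φ)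

end WordFormulas

/-- First-order string-to-string interpretations. -/
structure Interpretation (D : Type u) where
  /-- character constants -/
  A : Finset D
  /-- tags -/
  Tag : Type
  [fin : Fintype Tag]
  /-- arity function -/
  ar : Tag → ℕ
  /-- output function -/
  out : (t : Tag) → A ⊕ Fin (ar t)
  /-- domain formulas -/
  dom : (t : Tag) → WordFormula A (ar t)
  /-- order formulas: `ord t t'` says that `t(x)` comes before, or is equal to, `t'(y)` -/
  ord : (t t' : Tag) → WordFormula A (ar t + ar t')

attribute [instance] Interpretation.fin

namespace Interpretation

variable {D : Type u} (I : Interpretation D) (w : List D)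

/-- The elements of the interpretation on `w`: tags equipped with position tuples, which satisfy
the domain formula. -/
def Elem : Type :=
  {e : Σ t : I.Tag, (Fin (I.ar t) → Pos w) // (I.dom e.1).Holds w e.2}

noncomputable instance : Fintype (I.Elem w) := by
  classical
  unfold Elem
  infer_instance

/-- The relation on elements that is defined by the order formulas. -/
def le (e e' : I.Elem w) : Prop :=
  (I.ord e.1.1 e'.1.1).Holds w (Fin.append e.1.2 e'.1.2)

/-- The letter of an element. -/
def letter (e : I.Elem w) : D :=
  match I.out e.1.1 with
  | .inl a => (a : D)
  | .inr i => w.get (e.1.2 i)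

open Classical in
/-- The output on `w`: the letters of the elements, sorted according to the order formulas. It is
the empty word if these do not define a total order. -/
noncomputable def eval : List D :=
  if IsLinearOrder (I.Elem w) (I.le w) then
    ((Finset.univ : Finset (I.Elem w)).toList.mergeSort (fun a b => decide (I.le w a b))).map
      (I.letter w)
  else []

end Interpretation

/-! ## First-order formulas with the additional sort of booleans -/

/-- A boolean term: a free variable from `V`, one of the `j` bound variables, or a constant. -/
inductive BTerm (V : Type) (j : ℕ) : Type where
  | free (v : V)
  | bound (i : Fin j)
  | const (c : Bool)

namespace BTerm

variable {V V' : Type} {j j' : ℕ}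

/-- The same term in a context with one more bound variable. -/
def weaken : BTerm V j → BTerm V (j + 1)
  | free v => free v
  | bound i => bound i.castSucc
  | const c => const c

def subst (θ : V → BTerm V' j') (g : Fin j → Fin j') : BTerm V j → BTerm V' j'
  | free v => θ v
  | bound i => bound (g i)
  | const c => const c

def eval (ν : V → Bool) (β : Fin j → Bool) : BTerm V j → Bool
  | free v => ν v
  | bound i => β i
  | const c => c

end BTerm

/-- First-order formulas over two sorts, positions and booleans. A formula of type
`BFO A V k j` has `k` position variables, free boolean variables from `V`, and `j` further
boolean variables. Quantifiers bind the position variable number `k`, or the boolean variable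
number `j`. -/
inductive BFO {D : Type u} (A : Finset D) (V : Type) : ℕ → ℕ → Type u where
  | eq {k j : ℕ} (x y : Fin k) : BFO A V k j
  | lt {k j : ℕ} (x y : Fin k) : BFO A V k j
  | label {k j : ℕ} (x : Fin k) (a : A) : BFO A V k j
  /-- the boolean `t` is true -/
  | bool {k j : ℕ} (t : BTerm V j) : BFO A V k j
  | not {k j : ℕ} (φ : BFO A V k j) : BFO A V k j
  | and {k j : ℕ} (φ ψ : BFO A V k j) : BFO A V k j
  | or {k j : ℕ} (φ ψ : BFO A V k j) : BFO A V k j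
  | all {k j : ℕ} (φ : BFO A V (k + 1) j) : BFO A V k j
  | ex {k j : ℕ} (φ : BFO A V (k + 1) j) : BFO A V k j
  | allB {k j : ℕ} (φ : BFO A V k (j + 1)) : BFO A V k j
  | exB {k j : ℕ} (φ : BFO A V k (j + 1)) : BFO A V k j

namespace BFO

variable {D : Type u} {A : Finset D} {V V' : Type}

/-- Truth of a formula in the word `w`. -/
def Holds (w : List D) (ν : V → Bool) :
    {k j : ℕ} → BFO A V k j → (Fin k → Pos w) → (Fin j → Bool) → Prop
  | _, _, eq x y, ρ, _ => ρ x = ρ y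
  | _, _, lt x y, ρ, _ => ρ x < ρ y
  | _, _, label x a, ρ, _ => w.get (ρ x) = (a : D)
  | _, _, bool t, _, β => t.eval ν β = true
  | _, _, not φ, ρ, β => ¬ φ.Holds w ν ρ β
  | _, _, and φ ψ, ρ, β => φ.Holds w ν ρ β ∧ ψ.Holds w ν ρ β
  | _, _, or φ ψ, ρ, β => φ.Holds w ν ρ β ∨ ψ.Holds w ν ρ β
  | _, _, all φ, ρ, β => ∀ p : Pos w, φ.Holds w ν (push ρ p) β
  | _, _, ex φ, ρ, β => ∃ p : Pos w, φ.Holds w ν (push ρ p) β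
  | _, _, allB φ, ρ, β => ∀ c : Bool, φ.Holds w ν ρ (push β c)
  | _, _, exB φ, ρ, β => ∃ c : Bool, φ.Holds w ν ρ (push β c)

/-- The quantifier rank; quantifiers of both sorts count. -/
def qr : {k j : ℕ} → BFO A V k j → ℕ
  | _, _, eq _ _ => 0
  | _, _, lt _ _ => 0
  | _, _, label _ _ => 0
  | _, _, bool _ => 0
  | _, _, not φ => φ.qr
  | _, _, and φ ψ => max φ.qr ψ.qr
  | _, _, or φ ψ => max φ.qr ψ.qr
  | _, _, all φ => φ.qr + 1
  | _, _, ex φ => φ.qr + 1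
  | _, _, allB φ => φ.qr + 1
  | _, _, exB φ => φ.qr + 1

/-- Simultaneous substitution: position variables are renamed by `f`, free boolean variables are
replaced according to `θ`, and the `j` further boolean variables are renamed by `g`. -/
def subst : {k j k' j' : ℕ} → BFO A V k j → (Fin k → Fin k') → (V → BTerm V' j') →
    (Fin j → Fin j') → BFO A V' k' j'
  | _, _, _, _, eq x y, f, _, _ => eq (f x) (f y)
  | _, _, _, _, lt x y, f, _, _ => lt (f x) (f y)
  | _, _, _, _, label x a, f, _, _ => label (f x) a
  | _, _, _, _, bool t, _, θ, g => bool (t.subst θ g)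
  | _, _, _, _, not φ, f, θ, g => not (φ.subst f θ g)
  | _, _, _, _, and φ ψ, f, θ, g => and (φ.subst f θ g) (ψ.subst f θ g)
  | _, _, _, _, or φ ψ, f, θ, g => or (φ.subst f θ g) (ψ.subst f θ g)
  | _, _, _, _, all φ, f, θ, g =>
      all (φ.subst (push (fun x => (f x).castSucc) (Fin.last _)) θ g)
  | _, _, _, _, ex φ, f, θ, g =>
      ex (φ.subst (push (fun x => (f x).castSucc) (Fin.last _)) θ g)
  | _, _, _, _, allB φ, f, θ, g =>
      allB (φ.subst f (fun v => (θ v).weaken) (push (fun x => (g x).castSucc) (Fin.last _)))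
  | _, _, _, _, exB φ, f, θ, g =>
      exB (φ.subst f (fun v => (θ v).weaken) (push (fun x => (g x).castSucc) (Fin.last _)))

/-- Renaming of the position variables. -/
def rename {k k' j : ℕ} (f : Fin k → Fin k') (φ : BFO A V k j) : BFO A V k' j :=
  φ.subst f BTerm.free id

def top {k j : ℕ} : BFO A V k j := bool (.const true)

def iff {k j : ℕ} (φ ψ : BFO A V k j) : BFO A V k j := or (and φ ψ) (and (not φ) (not ψ))

def imp {k j : ℕ} (φ ψ : BFO A V k j) : BFO A V k j := or (not φ) ψ

/-- Finite conjunction. -/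
def conj {k j : ℕ} (l : List (BFO A V k j)) : BFO A V k j := l.foldr and top

/-- `c` existential quantifiers over positions. -/
def exs {k j : ℕ} : (c : ℕ) → BFO A V (k + c) j → BFO A V k j
  | 0, φ => φ
  | c + 1, φ => exs c (ex φ)

/-- `c` existential quantifiers over booleans. -/
def exBs {k j : ℕ} : (c : ℕ) → BFO A V k (j + c) → BFO A V k j
  | 0, φ => φ
  | c + 1, φ => exBs c (exB φ)

/-- Elimination of the boolean sort, for given values of the boolean variables: a quantifier over
booleans becomes a disjunction or a conjunction. -/
def toWord (ν : V → Bool) : {k j : ℕ} → BFO A V k j → (Fin j → Bool) → WordFormula A k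
  | _, _, eq x y, _ => WordFormula.eqV x y
  | _, _, lt x y, _ => WordFormula.ltV x y
  | _, _, label x a, _ => WordFormula.labelV x a
  | _, _, bool t, β => if t.eval ν β then ⊤ else ⊥
  | _, _, not φ, β => (φ.toWord ν β).not
  | _, _, and φ ψ, β => φ.toWord ν β ⊓ ψ.toWord ν β
  | _, _, or φ ψ, β => φ.toWord ν β ⊔ ψ.toWord ν β
  | _, _, all φ, β => (φ.toWord ν β).all
  | _, _, ex φ, β => (φ.toWord ν β).ex
  | _, _, allB φ, β => φ.toWord ν (push β true) ⊓ φ.toWord ν (push β false)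
  | _, _, exB φ, β => φ.toWord ν (push β true) ⊔ φ.toWord ν (push β false)

end BFO

/-! ## Program formulas -/

/-- The free boolean variables of program formulas, in a scope with `n` boolean variables: the
input variable and the output variable of every `b : Fin n`. -/
inductive PVar (n : ℕ) : Type where
  | inp (b : Fin n)
  | out (b : Fin n)

def BTerm.inVars {n j : ℕ} : BTerm (PVar n) j → Finset (Fin n)
  | free (.inp b) => {b}
  | _ => ∅

def BTerm.outVars {n j : ℕ} : BTerm (PVar n) j → Finset (Fin n)
  | free (.out b) => {b}
  | _ => ∅

namespace BFO

variable {D : Type u} {A : Finset D} {n : ℕ}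

/-- The input boolean variables that occur in a formula. -/
def inVars : {k j : ℕ} → BFO A (PVar n) k j → Finset (Fin n)
  | _, _, eq _ _ => ∅
  | _, _, lt _ _ => ∅
  | _, _, label _ _ => ∅
  | _, _, bool t => t.inVars
  | _, _, not φ => φ.inVars
  | _, _, and φ ψ => φ.inVars ∪ ψ.inVars
  | _, _, or φ ψ => φ.inVars ∪ ψ.inVars
  | _, _, all φ => φ.inVars
  | _, _, ex φ => φ.inVars
  | _, _, allB φ => φ.inVars
  | _, _, exB φ => φ.inVars

/-- The output boolean variables that occur in a formula. -/
def outVars : {k j : ℕ} → BFO A (PVar n) k j → Finset (Fin n)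
  | _, _, eq _ _ => ∅
  | _, _, lt _ _ => ∅
  | _, _, label _ _ => ∅
  | _, _, bool t => t.outVars
  | _, _, not φ => φ.outVars
  | _, _, and φ ψ => φ.outVars ∪ ψ.outVars
  | _, _, or φ ψ => φ.outVars ∪ ψ.outVars
  | _, _, all φ => φ.outVars
  | _, _, ex φ => φ.outVars
  | _, _, allB φ => φ.outVars
  | _, _, exB φ => φ.outVars

end BFO

/-- Program formulas in a scope with `k` position and `n` boolean variables. -/
abbrev PFormula {D : Type u} (A : Finset D) (k n : ℕ) : Type u := BFO A (PVar n) k 0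

/-- The input variable `b`, as a formula. -/
def inp {D : Type u} {A : Finset D} {k n j : ℕ} (b : Fin n) : BFO A (PVar n) k j :=
  .bool (.free (.inp b))

/-- The output variable `b`, as a formula. -/
def out {D : Type u} {A : Finset D} {k n j : ℕ} (b : Fin n) : BFO A (PVar n) k j :=
  .bool (.free (.out b))

/-- The elements of `S`, in increasing order. -/
def elems {n : ℕ} (S : Finset (Fin n)) : List (Fin n) := (List.finRange n).filter (· ∈ S)

/-- Among `S.card` bound boolean variables, the one that stands for `b ∈ S`. -/
def boundFor {V : Type} {n : ℕ} (S : Finset (Fin n)) (b : Fin n) (h : b ∈ S) :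
    BTerm V (0 + S.card) :=
  .bound (Fin.natAdd 0 ⟨rank S b, rank_lt h⟩)

/-- The clauses `b_in ↔ b_out` for `b ∈ S`. -/
def idClauses {D : Type u} {A : Finset D} {k n j : ℕ} (S : Finset (Fin n)) :
    BFO A (PVar n) k j :=
  .conj ((elems S).map fun b => .iff (inp b) (out b))

namespace PFormula

variable {D : Type u} {A : Finset D} {k n : ℕ}

/-- The relation between the input values `σ` and the output values `τ` that is defined by a program
formula, for given values `ρ` of the position variables. -/
def Rel (Φ : PFormula A k n) (w : List D) (ρ : Fin k → Pos w) (σ τ : Fin n → Bool) : Prop :=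
  Φ.Holds w (fun v => match v with
    | .inp b => σ b
    | .out b => τ b) ρ Fin.elim0

/-- The program formula `Φ` describes the transformation `F` of the values of the boolean variables:
it defines the function which maps the input values `σ` to the values under `F σ` of the output
variables of `Φ`, and `F` changes no other variable. -/
def Describes (Φ : PFormula A k n) (w : List D) (ρ : Fin k → Pos w)
    (F : (Fin n → Bool) → (Fin n → Bool)) : Prop :=
  (∀ σ τ, Φ.Rel w ρ σ τ ↔ ∀ b ∈ Φ.outVars, τ b = F σ b) ∧
    ∀ σ, ∀ b ∉ Φ.outVars, F σ b = σ b

/-- Conditional branching. The branches are extended by the identity on missing output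
variables. -/
def branch (φ Φ₁ Φ₂ : PFormula A k n) : PFormula A k n :=
  .or (.and φ (.and Φ₁ (idClauses (Φ₂.outVars \ Φ₁.outVars))))
    (.and (.not φ) (.and Φ₂ (idClauses (Φ₁.outVars \ Φ₂.outVars))))

/-- The variables whose intermediate values are quantified in the composition. -/
def shared (Φ₁ Φ₂ : PFormula A k n) : Finset (Fin n) :=
  Φ₁.outVars ∩ (Φ₂.inVars ∪ Φ₂.outVars)

/-- Sequencing `Φ₁ ; Φ₂`. The output variables of `Φ₁` which are consumed but not produced
by `Φ₂` are copied to the output. -/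
def comp (Φ₁ Φ₂ : PFormula A k n) : PFormula A k n :=
  .exBs (shared Φ₁ Φ₂).card
    (.and
      (Φ₁.subst id (fun v => match v with
        | .inp b => .free (.inp b)
        | .out b => if h : b ∈ shared Φ₁ Φ₂ then boundFor _ b h else .free (.out b)) Fin.elim0)
      (.and
        (Φ₂.subst id (fun v => match v with
          | .inp b => if h : b ∈ shared Φ₁ Φ₂ then boundFor _ b h else .free (.inp b)
          | .out b => .free (.out b)) Fin.elim0)
        (.conj ((elems (shared Φ₁ Φ₂ \ Φ₂.outVars)).map fun b =>
          .iff (if h : b ∈ shared Φ₁ Φ₂ then .bool (boundFor _ b h) else .top) (out b)))))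

/-- Sequencing `Φ ; φ` with a formula `φ` without output variables: `φ` holds in the state that is
reached by `Φ`. -/
def after (Φ φ : PFormula A k n) : PFormula A k n :=
  .exBs Φ.outVars.card
    (.and
      (Φ.subst id (fun v => match v with
        | .inp b => .free (.inp b)
        | .out b => if h : b ∈ Φ.outVars then boundFor _ b h else .const false) Fin.elim0)
      (φ.subst id (fun v => match v with
        | .inp b => if h : b ∈ Φ.outVars then boundFor _ b h else .free (.inp b)
        | .out _ => .const false) Fin.elim0))

/-- Initialise the last `m` boolean variables to `False`, and forget their final values. -/
def closeLocals {m : ℕ} (Φ : PFormula A k (n + m)) : PFormula A k n :=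
  let L := Φ.outVars.filter (fun b => n ≤ b.val)
  .exBs L.card
    (Φ.subst id (fun v => match v with
      | .inp b => if h : b.val < n then .free (.inp ⟨b.val, h⟩) else .const false
      | .out b => if h : b.val < n then .free (.out ⟨b.val, h⟩)
          else if h' : b ∈ L then boundFor L b h' else .const false) Fin.elim0)

section Iteration

variable {j : ℕ}

/-- `x` is visited strictly before `y`. -/
def before (d : Dir) (x y : Fin k) : BFO A (PVar n) k j :=
  match d with
  | .fwd => .lt x y
  | .bwd => .lt y x

/-- Among the bound variables for `c` vectors of booleans indexed by a set with `c` elements, the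
component number `r` of the vector number `i`. -/
def cell {c : ℕ} (i r : Fin c) : Fin (0 + c * c) := Fin.natAdd 0 (finProdFinEquiv (i, r))

/-- For `b ∈ B`, the component `b` of the vector number `i`. The vector number `0` is the vector of the
input variables, and the vectors number `1, …, B.card` are bound. Variables outside `B`
have their input values. -/
def vec (B : Finset (Fin n)) (i : Fin (B.card + 1)) (b : Fin n) :
    BTerm (PVar n) (0 + B.card * B.card) :=
  if h : b ∈ B then
    Fin.cases (motive := fun _ => BTerm (PVar n) (0 + B.card * B.card))
      (.free (.inp b)) (fun i' => .bound (cell i' ⟨rank B b, rank_lt h⟩)) i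
  else .free (.inp b)

/-- `Φ(x ; b_i ; b_i')`, for the position `x` and the vectors number `i` and `i'`. -/
def step {k' : ℕ} (Φ : PFormula A (k + 1) n) (f : Fin k → Fin k') (x : Fin k')
    (i i' : Fin (Φ.outVars.card + 1)) :
    BFO A (PVar n) k' (0 + Φ.outVars.card * Φ.outVars.card) :=
  Φ.subst (push f x) (fun v => match v with
    | .inp b => vec Φ.outVars i b
    | .out b => vec Φ.outVars i' b) Fin.elim0

/-- The vectors number `i` and `i'` are equal. -/
def sameVec {k' : ℕ} (B : Finset (Fin n)) (i i' : Fin (B.card + 1)) :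
    BFO A (PVar n) k' (0 + B.card * B.card) :=
  .conj ((elems B).map fun b => .iff (.bool (vec B i b)) (.bool (vec B i' b)))

/-- The accelerated iteration `Φ*` of a program formula over its last position variable. Let `c`
be the number of output variables of `Φ`. In a nonempty word, the formula guesses positions
`p_1, …, p_c`, weakly ordered as they are visited by the loop, and vectors of booleans
`b_1, …, b_c`, starts with the vector `b_0` of the input variables, and says that

* `Φ(p_i ; b_(i-1) ; b_i)` for every `i`, where a repeated position `p_i = p_(i-1)` is not
  executed again but satisfies `b_i = b_(i-1)`;
* `Φ(p ; b_i ; b_i)` for every position `p` strictly between `p_i` and `p_(i+1)`, where `p_0` and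
  `p_(c+1)` lie before and after all positions;
* `b_c` is the vector of the output variables. -/
def iter (d : Dir) (Φ : PFormula A (k + 1) n) : PFormula A k n :=
  let B := Φ.outVars
  let c := B.card
  .or (.and (.not (.ex .top)) (idClauses B))
    (.exs c (.exBs (c * c) (.conj
      [ .conj ((List.finRange c).map fun i => .conj ((List.finRange c).map fun i' =>
          if i.val + 1 = i'.val then
            .or (before d (Fin.natAdd k i) (Fin.natAdd k i')) (.eq (Fin.natAdd k i) (Fin.natAdd k i'))
          else .top)),
        .conj ((List.finRange c).map fun i =>
          if h : i.val = 0 then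
            step Φ (Fin.castAdd c) (Fin.natAdd k i) i.castSucc i.succ
          else
            let q : Fin c := ⟨i.val - 1, (Nat.sub_le _ _).trans_lt i.isLt⟩
            .or
              (.and (.eq (Fin.natAdd k q) (Fin.natAdd k i)) (sameVec B i.castSucc i.succ))
              (.and (.not (.eq (Fin.natAdd k q) (Fin.natAdd k i)))
                (step Φ (Fin.castAdd c) (Fin.natAdd k i) i.castSucc i.succ))),
        .conj ((List.finRange (c + 1)).map fun i => .all
          (.imp
            (.and
              (if h : i.val = 0 then .top
                else before d (Fin.natAdd k ⟨i.val - 1, by have hi : i.val < c + 1 := i.isLt; omega⟩ : Fin (k + c)).castSucc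
                  (Fin.last _))
              (if h : i.val < c then
                before d (Fin.last _) (Fin.natAdd k ⟨i.val, h⟩ : Fin (k + c)).castSucc
                else .top))
            (step Φ (fun x => (Fin.castAdd c x).castSucc) (Fin.last _) i i))),
        .conj ((elems B).map fun b => .iff (.bool (vec B (Fin.last c) b)) (out b)) ])))

/-- The iteration of `Φ` over the positions that are visited strictly before the last position
variable. -/
def iterBefore (d : Dir) (Φ : PFormula A (k + 1) n) : PFormula A (k + 1) n :=
  iter d (branch
    (before d (Fin.last (k + 1)) (Fin.last k).castSucc)
    (Φ.rename (push (fun x => x.castSucc.castSucc) (Fin.last (k + 1))))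
    .top)

end Iteration

end PFormula

section Compilation

variable {D : Type u} {A : Finset D}

/-- Conditions as formulas over the input variables. -/
def BExpr.toFormula {k n : ℕ} : BExpr A k n → PFormula A k n
  | .const c => .bool (.const c)
  | .not e => .not e.toFormula
  | .bin .and e₁ e₂ => .and e₁.toFormula e₂.toFormula
  | .bin .or e₁ e₂ => .or e₁.toFormula e₂.toFormula
  | .bin .imp e₁ e₂ => .imp e₁.toFormula e₂.toFormula
  | .bin .iff e₁ e₂ => .iff e₁.toFormula e₂.toFormula
  | .var b => inp b
  | .cmp .eq i j => .eq i j
  | .cmp .ne i j => .not (.eq i j)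
  | .cmp .lt i j => .lt i j
  | .cmp .le i j => .not (.lt j i)
  | .cmp .gt i j => .lt j i
  | .cmp .ge i j => .not (.lt i j)
  | .labelEq i a => .label i a

/-- The program formula of a statement. -/
def Stmt.toFormula : {k n : ℕ} → Stmt A k n → PFormula A k n
  | _, _, .skip => .top
  | _, _, .setTrue b => out b
  | _, _, .printConst _ => .top
  | _, _, .printLabel _ => .top
  | _, _, .ite e s₁ s₂ => PFormula.branch e.toFormula s₁.toFormula s₂.toFormula
  | _, _, .seq s₁ s₂ => PFormula.comp s₁.toFormula s₂.toFormula
  | _, _, .loop d _ body => PFormula.iter d (PFormula.closeLocals body.toFormula)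

/-- The occurrences of print statements in a statement. -/
def Stmt.Print : {k n : ℕ} → Stmt A k n → Type
  | _, _, .skip => Empty
  | _, _, .setTrue _ => Empty
  | _, _, .printConst _ => Unit
  | _, _, .printLabel _ => Unit
  | _, _, .ite _ s₁ s₂ => s₁.Print ⊕ s₂.Print
  | _, _, .seq s₁ s₂ => s₁.Print ⊕ s₂.Print
  | _, _, .loop _ _ body => body.Print

instance Stmt.fintypePrint : {k n : ℕ} → (s : Stmt A k n) → Fintype s.Print
  | _, _, .skip => inferInstanceAs (Fintype Empty)
  | _, _, .setTrue _ => inferInstanceAs (Fintype Empty)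
  | _, _, .printConst _ => inferInstanceAs (Fintype Unit)
  | _, _, .printLabel _ => inferInstanceAs (Fintype Unit)
  | _, _, .ite _ s₁ s₂ =>
      let _ := s₁.fintypePrint
      let _ := s₂.fintypePrint
      inferInstanceAs (Fintype (s₁.Print ⊕ s₂.Print))
  | _, _, .seq s₁ s₂ =>
      let _ := s₁.fintypePrint
      let _ := s₂.fintypePrint
      inferInstanceAs (Fintype (s₁.Print ⊕ s₂.Print))
  | _, _, .loop _ _ body => body.fintypePrint

/-- The number of position variables in the scope of a print statement. -/
def Stmt.ar : {k n : ℕ} → (s : Stmt A k n) → s.Print → ℕ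
  | _, _, .skip => Empty.elim
  | _, _, .setTrue _ => Empty.elim
  | k, _, .printConst _ => fun _ => k
  | k, _, .printLabel _ => fun _ => k
  | _, _, .ite _ s₁ s₂ => Sum.elim s₁.ar s₂.ar
  | _, _, .seq s₁ s₂ => Sum.elim s₁.ar s₂.ar
  | _, _, .loop _ _ body => body.ar

theorem Stmt.le_ar : {k n : ℕ} → (s : Stmt A k n) → (t : s.Print) → k ≤ s.ar t
  | _, _, .skip => fun t => Empty.elim t
  | _, _, .setTrue _ => fun t => Empty.elim t
  | k, _, .printConst _ => fun _ => le_refl k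
  | k, _, .printLabel _ => fun _ => le_refl k
  | _, _, .ite _ s₁ s₂ => fun t => match t with
      | Sum.inl t => s₁.le_ar t
      | Sum.inr t => s₂.le_ar t
  | _, _, .seq s₁ s₂ => fun t => match t with
      | Sum.inl t => s₁.le_ar t
      | Sum.inr t => s₂.le_ar t
  | _, _, .loop _ _ body => fun t => (Nat.le_succ _).trans (body.le_ar t)

/-- What a print statement prints: a constant, or the label of a position variable in its scope. -/
def Stmt.outLetter : {k n : ℕ} → (s : Stmt A k n) → (t : s.Print) → A ⊕ Fin (s.ar t)
  | _, _, .skip => fun t => Empty.elim t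
  | _, _, .setTrue _ => fun t => Empty.elim t
  | _, _, .printConst a => fun _ => Sum.inl a
  | _, _, .printLabel i => fun _ => Sum.inr i
  | _, _, .ite _ s₁ s₂ => fun t => match t with
      | Sum.inl t => s₁.outLetter t
      | Sum.inr t => s₂.outLetter t
  | _, _, .seq s₁ s₂ => fun t => match t with
      | Sum.inl t => s₁.outLetter t
      | Sum.inr t => s₂.outLetter t
  | _, _, .loop _ _ body => fun t => body.outLetter t

/-- The order formula of two print statements: their shared position variables are compared
lexicographically, according to the directions of the loops, and ties are broken by the order
in the source code. -/
def Stmt.ordFormula : {k n : ℕ} → (s : Stmt A k n) → (t t' : s.Print) →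
    WordFormula A (s.ar t + s.ar t')
  | _, _, .skip => fun t => Empty.elim t
  | _, _, .setTrue _ => fun t => Empty.elim t
  | _, _, .printConst _ => fun _ _ => ⊤
  | _, _, .printLabel _ => fun _ _ => ⊤
  | _, _, .ite _ s₁ s₂ => fun t t' => match t, t' with
      | Sum.inl t, Sum.inl t' => s₁.ordFormula t t'
      | Sum.inl _, Sum.inr _ => ⊤
      | Sum.inr _, Sum.inl _ => ⊥
      | Sum.inr t, Sum.inr t' => s₂.ordFormula t t'
  | _, _, .seq s₁ s₂ => fun t t' => match t, t' with
      | Sum.inl t, Sum.inl t' => s₁.ordFormula t t'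
      | Sum.inl _, Sum.inr _ => ⊤
      | Sum.inr _, Sum.inl _ => ⊥
      | Sum.inr t, Sum.inr t' => s₂.ordFormula t t'
  | k, _, .loop d _ body => fun t t' =>
      (WordFormula.lexV d (Fin.castAdd (body.ar t') ⟨k, body.le_ar t⟩)
        (Fin.natAdd (body.ar t) ⟨k, body.le_ar t'⟩) (body.ordFormula t t') :
        WordFormula A (body.ar t + body.ar t'))

/-- The print statement `t` is reached, when `s` is executed in the state given by the input variables
and the loops around `t` have the given positions. -/
def Stmt.domFormula : {k n : ℕ} → (s : Stmt A k n) → (t : s.Print) → PFormula A (s.ar t) n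
  | _, _, .skip => fun t => Empty.elim t
  | _, _, .setTrue _ => fun t => Empty.elim t
  | _, _, .printConst _ => fun _ => .top
  | _, _, .printLabel _ => fun _ => .top
  | _, _, .ite e s₁ s₂ => fun t => match t with
      | Sum.inl t => .and (e.toFormula.rename (Fin.castLE (s₁.le_ar t))) (s₁.domFormula t)
      | Sum.inr t => .and (.not (e.toFormula.rename (Fin.castLE (s₂.le_ar t)))) (s₂.domFormula t)
  | _, _, .seq s₁ s₂ => fun t => match t with
      | Sum.inl t => s₁.domFormula t
      | Sum.inr t =>
          PFormula.after (s₁.toFormula.rename (Fin.castLE (s₂.le_ar t))) (s₂.domFormula t)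
  | _, _, .loop d _ body => fun t =>
      PFormula.after
        ((PFormula.iterBefore d (PFormula.closeLocals body.toFormula)).rename
          (Fin.castLE (body.le_ar t)))
        (PFormula.closeLocals (body.domFormula t))

/-- The compilation of a program to an interpretation. Its tags are the print statements. -/
def Program.compile (P : Program D) : Interpretation D where
  A := P.A
  Tag := P.body.Print
  fin := P.body.fintypePrint
  ar := P.body.ar
  out := P.body.outLetter
  dom := fun t => (P.body.domFormula t).toWord (fun _ => false) Fin.elim0
  ord := P.body.ordFormula

end Compilation

end ForProg

open ForProg

/-! A statement acts on its boolean variables by a map, and its program formula is the graph of this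
map restricted to the variables it may write. Branching and sequencing are then bookkeeping:
identity clauses supply the outputs missing in a branch, and the intermediate state of a composition
is forced, since a described map is total and functional (`branch_describes`, `comp_describes`).

The substantial case is a loop. The only assignment is `b := True`, so a run of the loop never turns
a boolean off (`exec_mono`). Hence the state changes at most `c` times, where `c` is the number of
output variables of the body, and the whole loop is determined by the positions of the changes and
the states after them. A first-order formula can guess these data and check that all other positions
leave the state unchanged. `IsRun` isolates this combinatorial content: any run, with stuttering
allowed, computes the fold (`IsRun.foldl_eq`), and a monotone loop has a run of length exactly `c`,
obtained by padding the run of genuine changes (`exists_isRun`). `iter_describes` transfers both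
facts to the formula.

For the compilation, an execution is refined to its `trace`, the list of print events, that is,
print statements with the values of the loop variables around them. Three facts suffice. The printed
word is the image of the trace under the letter map (`exec_eq_map_trace`). An event is in the trace
exactly when its domain formula holds (`mem_trace`); for a loop this needs the state at the start of
an iteration, which is a guarded iteration and again monotone (`iterBefore_describes`). The trace is
strictly increasing for the order formulas (`pairwise_trace`), which define a linear order. So the
trace lists every element of the interpretation once and in sorted order, and a sorted enumeration
is unique (`eval_compile`). -/

namespace ForProg

universe u

/-! ### Tuples and indexing of finite sets of variables -/

section Tuples

variable {α β : Type*} {k : ℕ}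

@[simp] theorem push_castSucc (f : Fin k → α) (a : α) (i : Fin k) : push f a i.castSucc = f i := by
  simp [push]

@[simp] theorem push_last (f : Fin k → α) (a : α) : push f a (Fin.last k) = a := by
  simp [push]

theorem append_push {c : ℕ} (f : Fin k → α) (g : Fin c → α) (a : α) :
    Fin.append f (push g a) = push (Fin.append f g) a :=
  Fin.append_snoc f g a

theorem comp_push (h : α → β) (f : Fin k → α) (a : α) : h ∘ push f a = push (h ∘ f) (h a) := by
  funext i
  refine Fin.lastCases ?_ (fun i => ?_) i <;> simp

theorem push_comp_castSucc (f : Fin k → α) (a : α) : push f a ∘ Fin.castSucc = f := by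
  funext i; simp

theorem push_comp_push_castSucc {k' : ℕ} (ρ : Fin k' → α) (f : Fin k → Fin k') (p : α) :
    push ρ p ∘ push (fun x => (f x).castSucc) (Fin.last _) = push (ρ ∘ f) p := by
  rw [comp_push]
  congr 1
  · funext x; simp
  · simp

theorem exists_push_iff {P : (Fin (k + 1) → α) → Prop} :
    (∃ f, P f) ↔ ∃ (f : Fin k → α) (a : α), P (push f a) := by
  refine ⟨fun ⟨f, h⟩ => ⟨Fin.init f, f (Fin.last k), ?_⟩, fun ⟨f, a, h⟩ => ⟨_, h⟩⟩
  rwa [push, Fin.snoc_init_self]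

theorem append_castAdd_comp {c : ℕ} (f : Fin k → α) (g : Fin c → α) :
    Fin.append f g ∘ Fin.castAdd c = f := by
  funext i; simp

end Tuples

theorem mem_elems {n : ℕ} {S : Finset (Fin n)} {b : Fin n} : b ∈ elems S ↔ b ∈ S := by
  simp [elems]

/-- If `a < b` and `a ∈ S`, then `a` is counted in the rank of `b` but not in its own, so ranks
increase strictly along `S`. -/
theorem rank_injOn {n : ℕ} {S : Finset (Fin n)} {a b : Fin n} (ha : a ∈ S) (hb : b ∈ S)
    (h : rank S a = rank S b) : a = b := by
  have key : ∀ {a b : Fin n}, a ∈ S → a < b → rank S a < rank S b := by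
    intro a b ha hab
    apply Finset.card_lt_card
    refine ⟨fun x hx => ?_, fun h' => ?_⟩
    · rw [Finset.mem_filter] at hx ⊢
      exact ⟨hx.1, hx.2.trans hab⟩
    · exact lt_irrefl a (Finset.mem_filter.1 (h' (Finset.mem_filter.2 ⟨ha, hab⟩))).2
  rcases lt_trichotomy a b with hab | hab | hab
  · exact absurd h (key ha hab).ne
  · exact hab
  · exact absurd h (key hb hab).ne'

/-- Every family of values indexed by `S` is represented by values of `S.card` bound variables. -/
theorem exists_of_rank {n : ℕ} {α : Type*} [Inhabited α] (S : Finset (Fin n)) (f : Fin n → α) :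
    ∃ γ : Fin S.card → α, ∀ b (h : b ∈ S), γ ⟨rank S b, rank_lt h⟩ = f b := by
  classical
  refine ⟨fun r => if h : ∃ b ∈ S, rank S b = r.val then f h.choose else default,
    fun b hb => ?_⟩
  have h : ∃ b' ∈ S, rank S b' = rank S b := ⟨b, hb, rfl⟩
  simp only [dif_pos h]
  rw [rank_injOn h.choose_spec.1 hb h.choose_spec.2]

/-! ### Semantics of substitution and of blocks of quantifiers -/

namespace BTerm

variable {V V' : Type} {j j' : ℕ}

theorem eval_weaken (t : BTerm V j) (ν : V → Bool) (β : Fin j → Bool) (c : Bool) :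
    t.weaken.eval ν (push β c) = t.eval ν β := by
  cases t <;> simp [weaken, eval]

theorem eval_subst (t : BTerm V j) (θ : V → BTerm V' j') (g : Fin j → Fin j') (ν : V' → Bool)
    (β : Fin j' → Bool) :
    (t.subst θ g).eval ν β = t.eval (fun v => (θ v).eval ν β) (β ∘ g) := by
  cases t <;> rfl

end BTerm

/-- The values of `c` bound variables. -/
def boundVals {c : ℕ} (γ : Fin c → Bool) : Fin (0 + c) → Bool := Fin.append Fin.elim0 γ

@[simp] theorem boundVals_natAdd {c : ℕ} (γ : Fin c → Bool) (i : Fin c) :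
    boundVals γ (Fin.natAdd 0 i) = γ i :=
  Fin.append_right _ _ i

@[simp] theorem eval_boundFor {V : Type} {n : ℕ} (S : Finset (Fin n)) (b : Fin n) (h : b ∈ S)
    (ν : V → Bool) (γ : Fin S.card → Bool) :
    (boundFor S b h : BTerm V _).eval ν (boundVals γ) = γ ⟨rank S b, rank_lt h⟩ :=
  boundVals_natAdd γ _

/-- Quantified booleans are indexed by ranks in `S`, whereas states are functions on all variables.
The hypothesis demands equivalence whenever the two agree on `S`, so values outside `S` can be
chosen freely and the quantifiers can be exchanged. -/
theorem exists_vals_iff {n : ℕ} {S : Finset (Fin n)} {P : (Fin S.card → Bool) → Prop}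
    {Q : (Fin n → Bool) → Prop}
    (h : ∀ γ μ, (∀ b (h : b ∈ S), γ ⟨rank S b, rank_lt h⟩ = μ b) → (P γ ↔ Q μ)) :
    (∃ γ, P γ) ↔ ∃ μ, Q μ := by
  constructor
  · rintro ⟨γ, hγ⟩
    exact ⟨fun b => if hb : b ∈ S then γ ⟨rank S b, rank_lt hb⟩ else false,
      (h γ _ fun b hb => by simp [hb]).1 hγ⟩
  · rintro ⟨μ, hμ⟩
    obtain ⟨γ, hγ⟩ := exists_of_rank S μ
    exact ⟨γ, (h γ μ hγ).2 hμ⟩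

namespace BFO

variable {D : Type u} {A : Finset D} {V V' : Type}

theorem subst_holds (w : List D) (ν : V' → Bool) : ∀ {k j k' j' : ℕ} (φ : BFO A V k j)
    (f : Fin k → Fin k') (θ : V → BTerm V' j') (g : Fin j → Fin j') (ρ : Fin k' → Pos w)
    (β : Fin j' → Bool), (φ.subst f θ g).Holds w ν ρ β ↔
      φ.Holds w (fun v => (θ v).eval ν β) (ρ ∘ f) (β ∘ g)
  | _, _, _, _, eq _ _, _, _, _, _, _ => Iff.rfl
  | _, _, _, _, lt _ _, _, _, _, _, _ => Iff.rfl
  | _, _, _, _, label _ _, _, _, _, _, _ => Iff.rfl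
  | _, _, _, _, bool t, f, θ, g, ρ, β => by
      simp only [subst, Holds, BTerm.eval_subst]
  | _, _, _, _, not φ, f, θ, g, ρ, β => not_congr (subst_holds w ν φ f θ g ρ β)
  | _, _, _, _, and φ ψ, f, θ, g, ρ, β =>
      and_congr (subst_holds w ν φ f θ g ρ β) (subst_holds w ν ψ f θ g ρ β)
  | _, _, _, _, or φ ψ, f, θ, g, ρ, β =>
      or_congr (subst_holds w ν φ f θ g ρ β) (subst_holds w ν ψ f θ g ρ β)
  | _, _, _, _, all φ, f, θ, g, ρ, β => by
      simp only [subst, Holds, subst_holds w ν φ, push_comp_push_castSucc]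
  | _, _, _, _, ex φ, f, θ, g, ρ, β => by
      simp only [subst, Holds, subst_holds w ν φ, push_comp_push_castSucc]
  | _, _, _, _, allB φ, f, θ, g, ρ, β => by
      simp only [subst, Holds, subst_holds w ν φ, push_comp_push_castSucc, BTerm.eval_weaken]
  | _, _, _, _, exB φ, f, θ, g, ρ, β => by
      simp only [subst, Holds, subst_holds w ν φ, push_comp_push_castSucc, BTerm.eval_weaken]

/-- The induction peels off the innermost quantifier of the block, which binds the last entry of the
tuple `q`. -/
theorem exs_holds (w : List D) (ν : V → Bool) {k j : ℕ} : ∀ (c : ℕ) (φ : BFO A V (k + c) j)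
    (ρ : Fin k → Pos w) (β : Fin j → Bool), (exs c φ).Holds w ν ρ β ↔
      ∃ q : Fin c → Pos w, φ.Holds w ν (Fin.append ρ q) β
  | 0, φ, ρ, β => by
      simp only [exs, Fin.exists_fin_zero_pi, Fin.append_right_nil _ _ rfl]
      rfl
  | c + 1, φ, ρ, β => by
      simp only [exs]
      rw [exs_holds w ν c, exists_push_iff (k := c)]
      refine exists_congr fun q => exists_congr fun p => ?_
      exact iff_of_eq (congrArg (fun r => φ.Holds w ν r β) (append_push ρ q p).symm)

theorem exBs_holds (w : List D) (ν : V → Bool) {k j : ℕ} : ∀ (c : ℕ) (φ : BFO A V k (j + c))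
    (ρ : Fin k → Pos w) (β : Fin j → Bool), (exBs c φ).Holds w ν ρ β ↔
      ∃ γ : Fin c → Bool, φ.Holds w ν ρ (Fin.append β γ)
  | 0, φ, ρ, β => by
      simp only [exBs, Fin.exists_fin_zero_pi, Fin.append_right_nil _ _ rfl]
      rfl
  | c + 1, φ, ρ, β => by
      simp only [exBs]
      rw [exBs_holds w ν c, exists_push_iff (k := c)]
      refine exists_congr fun q => exists_congr fun p => ?_
      exact iff_of_eq (congrArg (fun r => φ.Holds w ν ρ r) (append_push β q p).symm)

theorem exBs_holds_zero (w : List D) (ν : V → Bool) {k : ℕ} (c : ℕ) (φ : BFO A V k (0 + c))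
    (ρ : Fin k → Pos w) : (exBs c φ).Holds w ν ρ Fin.elim0 ↔
      ∃ γ : Fin c → Bool, φ.Holds w ν ρ (boundVals γ) :=
  exBs_holds w ν c φ ρ Fin.elim0

theorem conj_holds (w : List D) (ν : V → Bool) {k j : ℕ} (l : List (BFO A V k j))
    (ρ : Fin k → Pos w) (β : Fin j → Bool) :
    (conj l).Holds w ν ρ β ↔ ∀ φ ∈ l, φ.Holds w ν ρ β := by
  induction l with
  | nil => simp [conj, top, Holds, BTerm.eval]
  | cons φ l ih =>
    simp only [List.forall_mem_cons, ← ih]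
    rfl

theorem top_holds (w : List D) (ν : V → Bool) {k j : ℕ} (ρ : Fin k → Pos w) (β : Fin j → Bool) :
    (top : BFO A V k j).Holds w ν ρ β := rfl

theorem iff_holds (w : List D) (ν : V → Bool) {k j : ℕ} (φ ψ : BFO A V k j)
    (ρ : Fin k → Pos w) (β : Fin j → Bool) :
    (iff φ ψ).Holds w ν ρ β ↔ (φ.Holds w ν ρ β ↔ ψ.Holds w ν ρ β) := by
  simp only [iff, Holds]
  tauto

theorem imp_holds (w : List D) (ν : V → Bool) {k j : ℕ} (φ ψ : BFO A V k j)
    (ρ : Fin k → Pos w) (β : Fin j → Bool) :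
    (imp φ ψ).Holds w ν ρ β ↔ (φ.Holds w ν ρ β → ψ.Holds w ν ρ β) := by
  simp only [imp, Holds]
  tauto

theorem conj_map_holds {ι : Type*} (w : List D) (ν : V → Bool) {k j : ℕ} (l : List ι)
    (f : ι → BFO A V k j) (ρ : Fin k → Pos w) (β : Fin j → Bool) :
    (conj (l.map f)).Holds w ν ρ β ↔ ∀ i ∈ l, (f i).Holds w ν ρ β := by
  simp [conj_holds]

/-! ### Quantifier rank -/

theorem qr_subst : ∀ {k j k' j' : ℕ} (φ : BFO A V k j) (f : Fin k → Fin k')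
    (θ : V → BTerm V' j') (g : Fin j → Fin j'), (φ.subst f θ g).qr = φ.qr
  | _, _, _, _, eq _ _, _, _, _ => rfl
  | _, _, _, _, lt _ _, _, _, _ => rfl
  | _, _, _, _, label _ _, _, _, _ => rfl
  | _, _, _, _, bool _, _, _, _ => rfl
  | _, _, _, _, not φ, f, θ, g => qr_subst φ f θ g
  | _, _, _, _, and φ ψ, f, θ, g => congrArg₂ max (qr_subst φ f θ g) (qr_subst ψ f θ g)
  | _, _, _, _, or φ ψ, f, θ, g => congrArg₂ max (qr_subst φ f θ g) (qr_subst ψ f θ g)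
  | _, _, _, _, all φ, _, _, _ => congrArg (· + 1) (qr_subst φ _ _ _)
  | _, _, _, _, ex φ, _, _, _ => congrArg (· + 1) (qr_subst φ _ _ _)
  | _, _, _, _, allB φ, _, _, _ => congrArg (· + 1) (qr_subst φ _ _ _)
  | _, _, _, _, exB φ, _, _, _ => congrArg (· + 1) (qr_subst φ _ _ _)

theorem qr_exs {k j : ℕ} : ∀ (c : ℕ) (φ : BFO A V (k + c) j), (exs c φ).qr = φ.qr + c
  | 0, _ => rfl
  | c + 1, φ => by
      rw [exs, qr_exs c]
      simp only [qr]
      omega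

theorem qr_exBs {k j : ℕ} : ∀ (c : ℕ) (φ : BFO A V k (j + c)), (exBs c φ).qr = φ.qr + c
  | 0, _ => rfl
  | c + 1, φ => by
      rw [exBs, qr_exBs c]
      simp only [qr]
      omega

theorem qr_conj_le {k j m : ℕ} {l : List (BFO A V k j)} (h : ∀ φ ∈ l, φ.qr ≤ m) :
    (conj l).qr ≤ m := by
  induction l with
  | nil => exact Nat.zero_le _
  | cons φ l ih =>
    rw [List.forall_mem_cons] at h
    exact max_le h.1 (ih h.2)

theorem qr_conj_map_le {ι : Type*} {k j m : ℕ} {l : List ι} {f : ι → BFO A V k j}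
    (h : ∀ i ∈ l, (f i).qr ≤ m) : (conj (l.map f)).qr ≤ m :=
  qr_conj_le (by simpa using h)

theorem qr_iff {k j : ℕ} (φ ψ : BFO A V k j) : (iff φ ψ).qr = max φ.qr ψ.qr :=
  max_self _

theorem qr_imp {k j : ℕ} (φ ψ : BFO A V k j) : (imp φ ψ).qr = max φ.qr ψ.qr := rfl

/-! ### Variables -/

variable {n : ℕ}

theorem holds_congr (w : List D) {ν ν' : PVar n → Bool} : ∀ {k j : ℕ} (φ : BFO A (PVar n) k j)
    (ρ : Fin k → Pos w) (β : Fin j → Bool), (∀ b ∈ φ.inVars, ν (.inp b) = ν' (.inp b)) →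
      (∀ b ∈ φ.outVars, ν (.out b) = ν' (.out b)) → (φ.Holds w ν ρ β ↔ φ.Holds w ν' ρ β)
  | _, _, eq _ _, _, _, _, _ => Iff.rfl
  | _, _, lt _ _, _, _, _, _ => Iff.rfl
  | _, _, label _ _, _, _, _, _ => Iff.rfl
  | _, _, bool t, _, _, h, h' => by
      cases t with
      | free v =>
        cases v with
        | inp b =>
          simp only [Holds, BTerm.eval]
          rw [h b (by simp [inVars, BTerm.inVars])]
        | out b =>
          simp only [Holds, BTerm.eval]
          rw [h' b (by simp [outVars, BTerm.outVars])]
      | bound i => exact Iff.rfl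
      | const c => exact Iff.rfl
  | _, _, not φ, ρ, β, h, h' => not_congr (holds_congr w φ ρ β h h')
  | _, _, and φ ψ, ρ, β, h, h' =>
      and_congr
        (holds_congr w φ ρ β (fun b hb => h b (Finset.mem_union_left _ hb))
          (fun b hb => h' b (Finset.mem_union_left _ hb)))
        (holds_congr w ψ ρ β (fun b hb => h b (Finset.mem_union_right _ hb))
          (fun b hb => h' b (Finset.mem_union_right _ hb)))
  | _, _, or φ ψ, ρ, β, h, h' =>
      or_congr
        (holds_congr w φ ρ β (fun b hb => h b (Finset.mem_union_left _ hb))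
          (fun b hb => h' b (Finset.mem_union_left _ hb)))
        (holds_congr w ψ ρ β (fun b hb => h b (Finset.mem_union_right _ hb))
          (fun b hb => h' b (Finset.mem_union_right _ hb)))
  | _, _, all φ, _, _, h, h' => forall_congr' fun _ => holds_congr w φ _ _ h h'
  | _, _, ex φ, _, _, h, h' => exists_congr fun _ => holds_congr w φ _ _ h h'
  | _, _, allB φ, _, _, h, h' => forall_congr' fun _ => holds_congr w φ _ _ h h'
  | _, _, exB φ, _, _, h, h' => exists_congr fun _ => holds_congr w φ _ _ h h'

theorem outVars_weaken {j : ℕ} (t : BTerm (PVar n) j) : t.weaken.outVars = t.outVars := by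
  cases t with
  | free v => cases v <;> rfl
  | bound i => rfl
  | const c => rfl

variable {n' : ℕ}

/-- Only variables that occur in `φ` contribute. This permits the exact computation of the output
variables of compositions and iterations, which is needed because `Describes` depends on them
syntactically. -/
theorem mem_outVars_subst : ∀ {k j k' j' : ℕ} (φ : BFO A (PVar n) k j) (f : Fin k → Fin k')
    (θ : PVar n → BTerm (PVar n') j') (g : Fin j → Fin j') (b : Fin n'),
    b ∈ (φ.subst f θ g).outVars ↔
      (∃ a ∈ φ.inVars, b ∈ (θ (.inp a)).outVars) ∨ ∃ a ∈ φ.outVars, b ∈ (θ (.out a)).outVars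
  | _, _, _, _, eq _ _, _, _, _, _ => by simp [subst, inVars, outVars]
  | _, _, _, _, lt _ _, _, _, _, _ => by simp [subst, inVars, outVars]
  | _, _, _, _, label _ _, _, _, _, _ => by simp [subst, inVars, outVars]
  | _, _, _, _, bool t, _, _, _, _ => by
      cases t with
      | free v => cases v <;> simp [subst, BTerm.subst, inVars, outVars, BTerm.inVars, BTerm.outVars]
      | bound i => simp [subst, BTerm.subst, inVars, outVars, BTerm.inVars, BTerm.outVars]
      | const c => simp [subst, BTerm.subst, inVars, outVars, BTerm.inVars, BTerm.outVars]
  | _, _, _, _, not φ, f, θ, g, b => mem_outVars_subst φ f θ g b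
  | _, _, _, _, and φ ψ, f, θ, g, b => by
      simp only [subst, inVars, outVars, Finset.mem_union, mem_outVars_subst φ,
        mem_outVars_subst ψ, or_and_right, exists_or]
      exact or_or_or_comm
  | _, _, _, _, or φ ψ, f, θ, g, b => by
      simp only [subst, inVars, outVars, Finset.mem_union, mem_outVars_subst φ,
        mem_outVars_subst ψ, or_and_right, exists_or]
      exact or_or_or_comm
  | _, _, _, _, all φ, _, _, _, _ => mem_outVars_subst φ _ _ _ _
  | _, _, _, _, ex φ, _, _, _, _ => mem_outVars_subst φ _ _ _ _
  | _, _, _, _, allB φ, _, _, _, _ => by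
      simp only [subst, inVars, outVars, mem_outVars_subst φ, outVars_weaken]
  | _, _, _, _, exB φ, _, _, _, _ => by
      simp only [subst, inVars, outVars, mem_outVars_subst φ, outVars_weaken]

theorem outVars_exs {k j : ℕ} : ∀ (c : ℕ) (φ : BFO A (PVar n) (k + c) j),
    (exs c φ).outVars = φ.outVars
  | 0, _ => rfl
  | c + 1, φ => by rw [exs, outVars_exs c]; rfl

theorem outVars_exBs {k j : ℕ} : ∀ (c : ℕ) (φ : BFO A (PVar n) k (j + c)),
    (exBs c φ).outVars = φ.outVars
  | 0, _ => rfl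
  | c + 1, φ => by rw [exBs, outVars_exBs c]; rfl

theorem mem_outVars_conj {k j : ℕ} {l : List (BFO A (PVar n) k j)} {b : Fin n} :
    b ∈ (conj l).outVars ↔ ∃ φ ∈ l, b ∈ φ.outVars := by
  induction l with
  | nil => simp [conj, top, outVars, BTerm.outVars]
  | cons φ l ih =>
    simp only [List.exists_mem_cons_iff, ← ih]
    exact Finset.mem_union

theorem mem_outVars_conj_map {ι : Type*} {k j : ℕ} {l : List ι} {f : ι → BFO A (PVar n) k j}
    {b : Fin n} : b ∈ (conj (l.map f)).outVars ↔ ∃ i ∈ l, b ∈ (f i).outVars := by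
  simp [mem_outVars_conj]

theorem mem_outVars_iff {k j : ℕ} {φ ψ : BFO A (PVar n) k j} {b : Fin n} :
    b ∈ (iff φ ψ).outVars ↔ b ∈ φ.outVars ∨ b ∈ ψ.outVars := by
  simp [iff, outVars]

theorem outVars_rename {k k' : ℕ} (f : Fin k → Fin k') (φ : BFO A (PVar n) k 0) :
    (φ.rename f).outVars = φ.outVars := by
  ext b
  simp only [rename, mem_outVars_subst]
  simp [BTerm.outVars]

end BFO

/-! ### Program formulas as relations between input and output states -/

@[simp] theorem outVars_top {D : Type u} {A : Finset D} {n k j : ℕ} :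
    (BFO.top : BFO A (PVar n) k j).outVars = ∅ := rfl

@[simp] theorem outVars_inp {D : Type u} {A : Finset D} {n k j : ℕ} (b : Fin n) :
    (inp b : BFO A (PVar n) k j).outVars = ∅ := rfl

@[simp] theorem outVars_out {D : Type u} {A : Finset D} {n k j : ℕ} (b : Fin n) :
    (out b : BFO A (PVar n) k j).outVars = {b} := rfl

@[simp] theorem outVars_boundFor {n m : ℕ} (S : Finset (Fin n)) (b : Fin n) (h : b ∈ S) :
    (boundFor S b h : BTerm (PVar m) _).outVars = ∅ := rfl

theorem outVars_idClauses {D : Type u} {A : Finset D} {n k j : ℕ} (S : Finset (Fin n)) :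
    (idClauses S : BFO A (PVar n) k j).outVars = S := by
  ext b
  simp only [idClauses, BFO.mem_outVars_conj_map, BFO.mem_outVars_iff, mem_elems]
  simp

theorem qr_idClauses {D : Type u} {A : Finset D} {n k j : ℕ} (S : Finset (Fin n)) :
    (idClauses S : BFO A (PVar n) k j).qr = 0 :=
  Nat.le_zero.1 (BFO.qr_conj_map_le fun _ _ => le_refl 0)

/-- The valuation with input values `σ` and output values `τ`. -/
def ioVal {n : ℕ} (σ τ : Fin n → Bool) : PVar n → Bool
  | .inp b => σ b
  | .out b => τ b

theorem idClauses_holds {D : Type u} {A : Finset D} {n k j : ℕ} (S : Finset (Fin n)) (w : List D)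
    (σ τ : Fin n → Bool) (ρ : Fin k → Pos w) (β : Fin j → Bool) :
    (idClauses S : BFO A (PVar n) k j).Holds w (ioVal σ τ) ρ β ↔ ∀ b ∈ S, τ b = σ b := by
  simp only [idClauses, BFO.conj_map_holds, BFO.iff_holds, mem_elems, inp, out, BFO.Holds,
    BTerm.eval, ioVal]
  refine forall₂_congr fun b _ => ?_
  rw [← Bool.eq_iff_iff]
  exact eq_comm

namespace PFormula

variable {D : Type u} {A : Finset D} {k n : ℕ}

/-- Replaces the anonymous `match` in `Rel` by the named valuation `ioVal`, which can be rewritten.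
-/
theorem rel_iff_holds (Φ : PFormula A k n) (w : List D) (ρ : Fin k → Pos w) (σ τ : Fin n → Bool) :
    Φ.Rel w ρ σ τ ↔ Φ.Holds w (ioVal σ τ) ρ Fin.elim0 := by
  have : ioVal σ τ = (fun v => match v with
      | .inp b => σ b
      | .out b => τ b) := by
    funext v; cases v <;> rfl
  rw [this]
  rfl

theorem rel_congr (Φ : PFormula A k n) (w : List D) (ρ : Fin k → Pos w) {σ σ' τ τ' : Fin n → Bool}
    (h : ∀ b ∈ Φ.inVars, σ b = σ' b) (h' : ∀ b ∈ Φ.outVars, τ b = τ' b) :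
    Φ.Rel w ρ σ τ ↔ Φ.Rel w ρ σ' τ' := by
  simp only [rel_iff_holds]
  exact Φ.holds_congr w ρ _ h h'

/-- A substitution instance is the relation at the substituted valuations. -/
theorem subst_rel {k' n' j' : ℕ} (Φ : PFormula A k n) (w : List D) (f : Fin k → Fin k')
    (θ : PVar n → BTerm (PVar n') j') (ν : PVar n' → Bool) (ρ : Fin k' → Pos w)
    (β : Fin j' → Bool) :
    (Φ.subst f θ Fin.elim0).Holds w ν ρ β ↔
      Φ.Rel w (ρ ∘ f) (fun b => (θ (.inp b)).eval ν β) (fun b => (θ (.out b)).eval ν β) := by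
  rw [BFO.subst_holds, rel_iff_holds]
  have h₁ : (fun v => (θ v).eval ν β) =
      ioVal (fun b => (θ (.inp b)).eval ν β) (fun b => (θ (.out b)).eval ν β) := by
    funext v; cases v <;> rfl
  rw [h₁, Subsingleton.elim (β ∘ Fin.elim0) Fin.elim0]

theorem rename_rel {k' : ℕ} (Φ : PFormula A k n) (w : List D) (f : Fin k → Fin k')
    (ρ : Fin k' → Pos w) (σ τ : Fin n → Bool) :
    Rel (Φ.rename f) w ρ σ τ ↔ Φ.Rel w (ρ ∘ f) σ τ := by
  rw [rel_iff_holds, BFO.rename, Subsingleton.elim (id : Fin 0 → Fin 0) Fin.elim0, subst_rel]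
  rfl

theorem Describes.rename {k' : ℕ} {Φ : PFormula A k n} {w : List D} {f : Fin k → Fin k'}
    {ρ : Fin k' → Pos w} {F : (Fin n → Bool) → Fin n → Bool} (h : Φ.Describes w (ρ ∘ f) F) :
    Describes (Φ.rename f) w ρ F := by
  refine ⟨fun σ τ => ?_, ?_⟩
  · rw [rename_rel, BFO.outVars_rename]
    exact h.1 σ τ
  · rw [BFO.outVars_rename]
    exact h.2

theorem describes_top (w : List D) (ρ : Fin k → Pos w) :
    Describes (BFO.top : PFormula A k n) w ρ id :=
  ⟨fun σ τ => by simp [rel_iff_holds, BFO.top_holds], fun _ _ _ => rfl⟩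

/-! ### Branching -/

/-- The identity clauses give both branches the same output variables, the union of the two sets. On
a variable that a branch lacks, its map is the identity, so the clause states exactly the required
output value. -/
theorem branch_describes {φ Φ₁ Φ₂ : PFormula A k n} (hφ : φ.outVars = ∅) {w : List D}
    {ρ : Fin k → Pos w} {c : (Fin n → Bool) → Bool} {F₁ F₂ : (Fin n → Bool) → (Fin n → Bool)}
    (hc : ∀ σ τ, PFormula.Rel φ w ρ σ τ ↔ c σ = true)
    (h₁ : PFormula.Describes Φ₁ w ρ F₁) (h₂ : PFormula.Describes Φ₂ w ρ F₂) :
    PFormula.Describes (PFormula.branch φ Φ₁ Φ₂) w ρ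
      (fun σ => if c σ = true then F₁ σ else F₂ σ) := by
  have hout : (branch φ Φ₁ Φ₂).outVars = Φ₁.outVars ∪ Φ₂.outVars := by
    ext b
    simp only [branch, BFO.outVars, hφ, outVars_idClauses, Finset.mem_union, Finset.mem_sdiff,
      Finset.notMem_empty]
    tauto
  refine ⟨fun σ τ => ?_, fun σ b hb => ?_⟩
  · have e₁ := h₁.1 σ τ
    have e₂ := h₂.1 σ τ
    have ec := hc σ τ
    rw [rel_iff_holds] at e₁ e₂ ec ⊢
    rw [hout]
    simp only [branch, BFO.Holds, e₁, e₂, ec, idClauses_holds, Finset.mem_union,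
      Finset.mem_sdiff]
    cases c σ
    rotate_left
    · simp only [if_true, true_and, not_true, false_and, or_false]
      constructor
      · rintro ⟨ha, hb⟩ b hb'
        by_cases hb₁ : b ∈ Φ₁.outVars
        · exact ha b hb₁
        · rw [hb b ⟨hb'.resolve_left hb₁, hb₁⟩, h₁.2 σ b hb₁]
      · intro h
        exact ⟨fun b hb => h b (Or.inl hb), fun b hb => by rw [h b (Or.inr hb.1), h₁.2 σ b hb.2]⟩
    · simp only [Bool.false_eq_true, if_false, false_and, not_false_iff, true_and, false_or]
      constructor
      · rintro ⟨ha, hb⟩ b hb'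
        by_cases hb₂ : b ∈ Φ₂.outVars
        · exact ha b hb₂
        · rw [hb b ⟨hb'.resolve_right hb₂, hb₂⟩, h₂.2 σ b hb₂]
      · intro h
        exact ⟨fun b hb => h b (Or.inr hb), fun b hb => by rw [h b (Or.inl hb.1), h₂.2 σ b hb.2]⟩
  · rw [hout, Finset.mem_union, not_or] at hb
    dsimp only
    split_ifs
    · exact h₁.2 σ b hb.1
    · exact h₂.2 σ b hb.2

/-! ### Sequencing -/

/-- No output of `Φ₁` is lost: one that becomes bound because it is shared is either written again
by `Φ₂` or restored by a copy clause. -/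
theorem outVars_comp (Φ₁ Φ₂ : PFormula A k n) :
    (comp Φ₁ Φ₂).outVars = Φ₁.outVars ∪ Φ₂.outVars := by
  ext b
  simp only [comp, BFO.outVars_exBs, BFO.outVars, Finset.mem_union, BFO.mem_outVars_subst,
    BFO.mem_outVars_conj_map, BFO.mem_outVars_iff, mem_elems, outVars_out, Finset.mem_singleton,
    Finset.mem_sdiff]
  have e₁ : ∀ a, b ∈ BTerm.outVars (if h : a ∈ shared Φ₁ Φ₂ then
      (boundFor _ a h : BTerm (PVar n) _) else .free (.out a)) ↔ a ∉ shared Φ₁ Φ₂ ∧ b = a := by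
    intro a
    split_ifs with h
    · simp [h]
    · simp [h, BTerm.outVars]
  have e₂ : ∀ a, b ∈ BTerm.outVars (if h : a ∈ shared Φ₁ Φ₂ then
      (boundFor _ a h : BTerm (PVar n) _) else .free (.inp a)) ↔ False := by
    intro a
    split_ifs with h
    · simp
    · simp [BTerm.outVars]
  have e₃ : ∀ a, b ∈ BFO.outVars (if h : a ∈ shared Φ₁ Φ₂ then
      (.bool (boundFor _ a h) : BFO A (PVar n) k _) else .top) ↔ False := by
    intro a
    split_ifs with h <;> simp [BFO.outVars]
  have e₄ : ∀ a, b ∈ BTerm.outVars (.free (.out a) : BTerm (PVar n)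
      (0 + (shared Φ₁ Φ₂).card)) ↔ b = a := by
    intro a; simp [BTerm.outVars]
  have e₅ : ∀ a, b ∈ BTerm.outVars (.free (.inp a) : BTerm (PVar n)
      (0 + (shared Φ₁ Φ₂).card)) ↔ False := by
    intro a; simp [BTerm.outVars]
  simp only [e₁, e₂, e₃, e₄, e₅, and_false, exists_false, false_or]
  have hs : b ∈ shared Φ₁ Φ₂ → b ∈ Φ₁.outVars := fun h => (Finset.mem_inter.1 h).1
  constructor
  · rintro (⟨a, ha, -, rfl⟩ | ⟨a, ha, rfl⟩ | ⟨a, ⟨ha, -⟩, rfl⟩)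
    · exact Or.inl ha
    · exact Or.inr ha
    · exact Or.inl (hs ha)
  · intro h
    by_cases h₂ : b ∈ Φ₂.outVars
    · exact Or.inr (Or.inl ⟨b, h₂, rfl⟩)
    · by_cases h₃ : b ∈ shared Φ₁ Φ₂
      · exact Or.inr (Or.inr ⟨b, ⟨h₃, h₂⟩, rfl⟩)
      · exact Or.inl ⟨b, h.resolve_right h₂, h₃, rfl⟩

/-- The intermediate state `μ` matters only on the shared variables. Every other output of `Φ₁` is
neither read nor written by `Φ₂`, so it is already the final value and is taken from `τ`. -/
theorem comp_rel (Φ₁ Φ₂ : PFormula A k n) (w : List D) (ρ : Fin k → Pos w) (σ τ : Fin n → Bool) :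
    (comp Φ₁ Φ₂).Rel w ρ σ τ ↔ ∃ μ : Fin n → Bool,
      Φ₁.Rel w ρ σ (fun b => if b ∈ shared Φ₁ Φ₂ then μ b else τ b) ∧
      Φ₂.Rel w ρ (fun b => if b ∈ shared Φ₁ Φ₂ then μ b else σ b) τ ∧
      ∀ b ∈ shared Φ₁ Φ₂ \ Φ₂.outVars, τ b = μ b := by
  rw [rel_iff_holds, comp, BFO.exBs_holds_zero]
  refine exists_vals_iff fun γ μ hγ => ?_
  simp only [BFO.Holds, subst_rel, Function.comp_id, BFO.conj_map_holds, mem_elems, BFO.iff_holds]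
  refine and_congr ?_ (and_congr ?_ ?_)
  · refine iff_of_eq (congrArg₂ _ (funext fun b => rfl) (funext fun b => ?_))
    by_cases h : b ∈ shared Φ₁ Φ₂
    · simp [h, hγ]
    · simp [h, BTerm.eval, ioVal]
  · refine iff_of_eq (congrArg₂ _ (funext fun b => ?_) (funext fun b => rfl))
    by_cases h : b ∈ shared Φ₁ Φ₂
    · simp [h, hγ]
    · simp [h, BTerm.eval, ioVal]
  · refine forall₂_congr fun b hb => ?_
    have h := (Finset.mem_sdiff.1 hb).1
    simp only [h, dif_pos, BFO.Holds, eval_boundFor, hγ]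
    simp only [out, BFO.Holds, BTerm.eval, ioVal]
    rw [← Bool.eq_iff_iff]
    exact eq_comm

/-- The clause for `Φ₁` forces `μ` to agree with `F₁ σ` on the shared variables. An unshared input
of `Φ₂` is not an output of `Φ₁`, so there `σ` and `F₁ σ` agree. Hence `Φ₂` effectively starts in
`F₁ σ`. -/
theorem comp_describes {Φ₁ Φ₂ : PFormula A k n} {w : List D} {ρ : Fin k → Pos w}
    {F₁ F₂ : (Fin n → Bool) → (Fin n → Bool)} (h₁ : Φ₁.Describes w ρ F₁)
    (h₂ : Φ₂.Describes w ρ F₂) : (comp Φ₁ Φ₂).Describes w ρ (fun σ => F₂ (F₁ σ)) := by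
  refine ⟨fun σ τ => ?_, fun σ b hb => ?_⟩
  · rw [comp_rel, outVars_comp]
    have key : ∀ μ : Fin n → Bool, (∀ b ∈ shared Φ₁ Φ₂, μ b = F₁ σ b) →
        (Φ₂.Rel w ρ (fun b => if b ∈ shared Φ₁ Φ₂ then μ b else σ b) τ ↔
          ∀ b ∈ Φ₂.outVars, τ b = F₂ (F₁ σ) b) := by
      intro μ hμ
      rw [← h₂.1]
      refine Φ₂.rel_congr w ρ (fun b hb => ?_) fun _ _ => rfl
      by_cases hs : b ∈ shared Φ₁ Φ₂
      · simp [hs, hμ]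
      · simp only [hs, if_false]
        refine (h₁.2 σ b fun hb' => hs ?_).symm
        exact Finset.mem_inter.2 ⟨hb', Finset.mem_union_left _ hb⟩
    simp only [h₁.1]
    constructor
    · rintro ⟨μ, ha, hb, hc⟩ b hbo
      have hμ : ∀ b ∈ shared Φ₁ Φ₂, μ b = F₁ σ b := fun b hs => by
        have := ha b (Finset.mem_inter.1 hs).1
        simpa [hs] using this
      by_cases hb₂ : b ∈ Φ₂.outVars
      · exact (key μ hμ).1 hb b hb₂
      · have hb₁ := (Finset.mem_union.1 hbo).resolve_right hb₂
        rw [h₂.2 _ b hb₂]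
        by_cases hs : b ∈ shared Φ₁ Φ₂
        · rw [hc b (Finset.mem_sdiff.2 ⟨hs, hb₂⟩), hμ b hs]
        · simpa [hs] using ha b hb₁
    · intro h
      refine ⟨F₁ σ, fun b hb => ?_, (key _ fun _ _ => rfl).2 fun b hb =>
        h b (Finset.mem_union_right _ hb), fun b hb => ?_⟩
      · by_cases hs : b ∈ shared Φ₁ Φ₂
        · simp [hs]
        · have hb₂ : b ∉ Φ₂.outVars := fun hb' =>
            hs (Finset.mem_inter.2 ⟨hb, Finset.mem_union_right _ hb'⟩)
          simp only [hs, if_false]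
          rw [h b (Finset.mem_union_left _ hb), h₂.2 _ b hb₂]
      · rw [Finset.mem_sdiff] at hb
        rw [h b (Finset.mem_union_left _ (Finset.mem_inter.1 hb.1).1), h₂.2 _ b hb.2]
  · rw [outVars_comp, Finset.mem_union, not_or] at hb
    dsimp only
    rw [h₂.2 _ b hb.2, h₁.2 _ b hb.1]

theorem qr_comp_le (Φ₁ Φ₂ : PFormula A k n) :
    (comp Φ₁ Φ₂).qr ≤ max Φ₁.qr Φ₂.qr + (Φ₁.outVars ∩ (Φ₂.inVars ∪ Φ₂.outVars)).card := by
  rw [comp, BFO.qr_exBs]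
  refine Nat.add_le_add_right ?_ _
  simp only [BFO.qr, BFO.qr_subst]
  refine max_le (le_max_left _ _) (max_le (le_max_right _ _) ?_)
  refine BFO.qr_conj_map_le fun b _ => ?_
  rw [BFO.qr_iff]
  split_ifs <;> exact Nat.zero_le _

/-- `after Φ φ` says that `φ` holds in the state reached by `Φ`. -/
theorem after_rel {Φ : PFormula A k n} (φ : PFormula A k n) {w : List D} {ρ : Fin k → Pos w}
    {F : (Fin n → Bool) → (Fin n → Bool)} (h : Φ.Describes w ρ F) (σ τ : Fin n → Bool) :
    (after Φ φ).Rel w ρ σ τ ↔ φ.Rel w ρ (F σ) (fun _ => false) := by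
  rw [rel_iff_holds, after, BFO.exBs_holds_zero]
  simp only [BFO.Holds, subst_rel, Function.comp_id]
  -- The state seen by `φ` mixes bound values on the outputs of `Φ` with inputs elsewhere. As `F`
  -- changes only the outputs, this mixture is the whole state `F σ`.
  have key : ∀ γ : Fin Φ.outVars.card → Bool,
      (∀ b (hb : b ∈ Φ.outVars), γ ⟨rank Φ.outVars b, rank_lt hb⟩ = F σ b) →
      (fun b => BTerm.eval (ioVal σ τ) (boundVals γ) (if h : b ∈ Φ.outVars then
        boundFor _ b h else .free (.inp b))) = F σ := by
    intro γ hγ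
    funext b
    by_cases hb : b ∈ Φ.outVars
    · simp [hb, hγ]
    · simp [hb, BTerm.eval, ioVal, h.2]
  constructor
  · rintro ⟨γ, h₁, h₂⟩
    have h₁' := (h.1 σ _).1 h₁
    rw [key γ fun b hb => by simpa [hb] using h₁' b hb] at h₂
    exact h₂
  · intro h₂
    obtain ⟨γ, hγ⟩ := exists_of_rank Φ.outVars (F σ)
    refine ⟨γ, (h.1 σ _).2 fun b hb => ?_, ?_⟩
    · simp [hb, hγ]
    · rw [key γ hγ]
      exact h₂

/-! ### Local variables -/

/-- Only the local variables that occur as outputs are quantified in the formula. Ranging over all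
local output values gives the same relation, because the others have no influence. -/
theorem closeLocals_rel {m : ℕ} (Φ : PFormula A k (n + m)) (w : List D) (ρ : Fin k → Pos w)
    (σ τ : Fin n → Bool) :
    (closeLocals Φ).Rel w ρ σ τ ↔ ∃ μ : Fin m → Bool,
      Φ.Rel w ρ (Fin.append σ fun _ => false) (Fin.append τ μ) := by
  rw [rel_iff_holds, closeLocals, BFO.exBs_holds_zero]
  -- The values of the locals are extended to all `n + m` variables, the index type of the set of
  -- quantified variables; the values on the first `n` are ignored.
  have h₁ : (∃ μ : Fin m → Bool, Φ.Rel w ρ (Fin.append σ fun _ => false) (Fin.append τ μ)) ↔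
      ∃ μ : Fin (n + m) → Bool, Φ.Rel w ρ (Fin.append σ fun _ => false)
        (Fin.append τ fun i => μ (Fin.natAdd n i)) := by
    constructor
    · rintro ⟨μ, h⟩
      exact ⟨Fin.append τ μ, by simpa using h⟩
    · rintro ⟨μ, h⟩
      exact ⟨_, h⟩
  rw [h₁]
  refine exists_vals_iff fun γ μ hγ => ?_
  rw [subst_rel, Function.comp_id]
  refine Φ.rel_congr w ρ (fun b _ => ?_) fun b hb => ?_
  · refine Fin.addCases (fun i => ?_) (fun i => ?_) b
    · simp [BTerm.eval, ioVal]
    · simp [BTerm.eval]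
  · revert hb
    refine Fin.addCases (fun i => ?_) (fun i => ?_) b
    · simp [BTerm.eval, ioVal]
    · intro hb
      have hL : Fin.natAdd n i ∈ Φ.outVars.filter (fun b => n ≤ b.val) := by simp [hb]
      have hn : ¬ (Fin.natAdd n i).val < n := by simp
      simp only [dif_neg hn, dif_pos hL, eval_boundFor, Fin.append_right]
      exact hγ _ hL

theorem mem_outVars_closeLocals {m : ℕ} (Φ : PFormula A k (n + m)) (b : Fin n) :
    b ∈ (closeLocals Φ).outVars ↔ Fin.castAdd m b ∈ Φ.outVars := by
  simp only [closeLocals, BFO.outVars_exBs, BFO.mem_outVars_subst]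
  constructor
  · rintro (⟨a, -, h⟩ | ⟨a, ha, h⟩)
    · split_ifs at h <;> simp [BTerm.outVars] at h
    · split_ifs at h with h₁ h₂
      · rw [BTerm.outVars, Finset.mem_singleton] at h
        subst h
        exact ha
      · simp at h
      · simp [BTerm.outVars] at h
  · intro h
    refine Or.inr ⟨_, h, ?_⟩
    simp [BTerm.outVars]

theorem closeLocals_describes {m : ℕ} {Φ : PFormula A k (n + m)} {w : List D} {ρ : Fin k → Pos w}
    {F : (Fin (n + m) → Bool) → (Fin (n + m) → Bool)} (h : Φ.Describes w ρ F) :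
    (closeLocals Φ).Describes w ρ
      (fun σ b => F (Fin.append σ fun _ => false) (Fin.castAdd m b)) := by
  refine ⟨fun σ τ => ?_, fun σ b hb => ?_⟩
  · simp only [closeLocals_rel, h.1, mem_outVars_closeLocals]
    constructor
    · rintro ⟨μ, hμ⟩ b hb
      simpa using hμ _ hb
    · intro hτ
      refine ⟨fun i => F (Fin.append σ fun _ => false) (Fin.natAdd n i), fun b => ?_⟩
      refine Fin.addCases (fun i hi => ?_) (fun i hi => ?_) b
      · simpa using hτ i hi
      · simp
  · rw [mem_outVars_closeLocals] at hb
    exact (h.2 _ _ hb).trans (Fin.append_left _ _ _)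

end PFormula

/-! ### The order of a loop -/

/-- `i` is visited strictly before `j`. -/
def Dir.Before {N : ℕ} : Dir → Fin N → Fin N → Prop
  | .fwd, i, j => i < j
  | .bwd, i, j => j < i

namespace Dir

variable {N : ℕ} (d : Dir)

theorem Before.irrefl (i : Fin N) : ¬ d.Before i i := by
  cases d <;> exact lt_irrefl i

variable {d}

theorem Before.trans {i j l : Fin N} (h : d.Before i j) (h' : d.Before j l) : d.Before i l := by
  cases d
  · exact lt_trans (α := Fin N) h h'
  · exact lt_trans (α := Fin N) h' h

theorem Before.asymm {i j : Fin N} (h : d.Before i j) : ¬ d.Before j i := fun h' =>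
  Before.irrefl d i (h.trans h')

variable (d)

theorem Before.trichotomy (i j : Fin N) : d.Before i j ∨ i = j ∨ d.Before j i := by
  cases d
  · exact lt_trichotomy i j
  · rcases lt_trichotomy i j with h | h | h
    · exact Or.inr (Or.inr h)
    · exact Or.inr (Or.inl h)
    · exact Or.inl h

theorem pairwise_positions {D : Type u} (w : List D) : (d.positions w).Pairwise d.Before := by
  cases d
  · exact List.pairwise_lt_finRange _
  · exact List.pairwise_reverse.2 (List.pairwise_lt_finRange _)

theorem mem_positions {D : Type u} (w : List D) (p : Pos w) : p ∈ d.positions w := by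
  cases d <;> simp [positions]

end Dir

/-! ### Accelerated runs

A run of length `c` along a sorted list consists of positions `q 0, …, q (c - 1)` and states
`V 0, …, V c`. -/

section Runs

variable {α S : Type*} (r : α → α → Prop) (F : α → S → S)

/-- The state changes from `V i` to `V (i + 1)` at the position `q i`, and does not change at the
other positions; a repeated position is not executed again. -/
structure IsRun (c : ℕ) (q : ℕ → α) (V : ℕ → S) : Prop where
  mono : ∀ i, i + 1 < c → r (q i) (q (i + 1)) ∨ q i = q (i + 1)
  step : ∀ i < c, (0 < i ∧ q (i - 1) = q i ∧ V i = V (i + 1)) ∨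
    ((0 < i → q (i - 1) ≠ q i) ∧ F (q i) (V i) = V (i + 1))
  gap : ∀ i ≤ c, ∀ p, (0 < i → r (q (i - 1)) p) → (i < c → r p (q i)) → F p (V i) = V i

variable {r F} {c : ℕ} {q : ℕ → α} {V : ℕ → S}

theorem IsRun.le (h : IsRun r F c q V) (htrans : ∀ {x y z}, r x y → r y z → r x z) {i j : ℕ}
    (hij : i ≤ j) (hj : j < c) : r (q i) (q j) ∨ q i = q j := by
  induction j, hij using Nat.le_induction with
  | base => exact Or.inr rfl
  | succ j hij ih =>
    have h₁ := ih (by omega)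
    rcases h.mono j hj with h₂ | h₂
    · rcases h₁ with h₁ | h₁
      · exact Or.inl (htrans h₁ h₂)
      · exact Or.inl (h₁ ▸ h₂)
    · rwa [← h₂]

/-- A run computes the iteration of the maps `F p` along the list of all positions. -/
theorem IsRun.foldl_eq (h : IsRun r F c q V) (hirr : ∀ x, ¬ r x x)
    (htrans : ∀ {x y z}, r x y → r y z → r x z) {L : List α} (hL : L.Pairwise r)
    (hmem : ∀ p, p ∈ L) : L.foldl (fun s p => F p s) (V 0) = V c := by
  -- Invariant for a prefix `L₁` of the positions: the indices of run positions in `L₁` form an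
  -- initial segment of length `i`, and the loop has reached the state `V i`.
  have main : ∀ L₁ L₂ : List α, L₁ ++ L₂ = L → ∃ i ≤ c, (∀ j < c, j < i ↔ q j ∈ L₁) ∧
      L₁.foldl (fun s p => F p s) (V 0) = V i := by
    intro L₁
    induction L₁ using List.reverseRecOn with
    | nil =>
      intro L₂ _
      exact ⟨0, Nat.zero_le _, by simp, rfl⟩
    | append_singleton L₁ p ih =>
      intro L₂ hL₂
      obtain ⟨i, hic, hi, hV⟩ := ih (p :: L₂) (by rw [← hL₂]; simp)
      rw [← hL₂, List.append_assoc, List.pairwise_append] at hL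
      obtain ⟨-, h₂, h₁₂⟩ := hL
      have hlt : ∀ x ∈ L₁, r x p := fun x hx => h₁₂ x hx p (by simp)
      have hgt : ∀ x ∈ L₂, r p x := fun x hx =>
        (List.pairwise_cons.1 h₂).1 x hx
      have hcases : ∀ x, x ∈ L₁ ∨ x = p ∨ x ∈ L₂ := fun x => by
        have := hmem x
        rw [← hL₂] at this
        simpa [or_assoc] using this
      have hbelow : ∀ x, r x p → x ∈ L₁ := fun x hx => by
        rcases hcases x with h' | rfl | h'
        · exact h'
        · exact absurd hx (hirr x)
        · exact absurd (htrans hx (hgt x h')) (hirr x)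
      have habove : ∀ x, x ∉ L₁ → x ≠ p → r p x := fun x h₁ h₂ =>
        hgt x (((hcases x).resolve_left h₁).resolve_left h₂)
      simp only [List.foldl_append, List.foldl_cons, List.foldl_nil, hV]
      -- After `p` has been executed once, all further indices repeating `p` are skipped; they are
      -- forced to stutter, so the state stays the same until the first index beyond `p`.
      have inner : ∀ m i, c - i = m → 0 < i → i ≤ c → q (i - 1) = p →
          (∀ j < c, i ≤ j → q j ∉ L₁) →
          ∃ i' ≤ c, (∀ j < c, j < i' ↔ q j ∈ L₁ ++ [p]) ∧ V i = V i' := by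
        intro m
        induction m with
        | zero =>
          intro i hm h0 hic hq hn
          refine ⟨i, hic, fun j hj => ⟨fun hji => ?_, fun _ => by omega⟩, rfl⟩
          rcases h.le htrans (show j ≤ i - 1 by omega) (by omega) with h' | h'
          · exact List.mem_append_left _ (hbelow _ (hq ▸ h'))
          · simp [h', hq]
        | succ m ihm =>
          intro i hm h0 hic hq hn
          by_cases hqi : q i = p
          · obtain ⟨i', h₁, h₂, h₃⟩ := ihm (i + 1) (by omega) (by omega) (by omega)
              (by simpa using hqi) (fun j hj hij => hn j hj (by omega))
            refine ⟨i', h₁, h₂, ?_⟩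
            rw [← h₃]
            rcases h.step i (by omega) with h' | h'
            · exact h'.2.2
            · exact absurd (hq.trans hqi.symm) (h'.1 h0)
          · refine ⟨i, hic, fun j hj => ⟨fun hji => ?_, fun hjm => ?_⟩, rfl⟩
            · rcases h.le htrans (show j ≤ i - 1 by omega) (by omega) with h' | h'
              · exact List.mem_append_left _ (hbelow _ (hq ▸ h'))
              · simp [h', hq]
            · by_contra hij
              rw [List.mem_append, List.mem_singleton] at hjm
              have hqj := hjm.resolve_left (hn j hj (by omega))
              rcases h.le htrans (show i ≤ j by omega) hj with h' | h'
              · exact hn i (by omega) le_rfl (hbelow _ (hqj ▸ h'))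
              · exact hqi (h'.trans hqj)
      -- Either `p` is the next position of the run, and the `step` condition applies, or it lies in
      -- the gap before the next position, and the state does not change.
      by_cases hqi : i < c ∧ q i = p
      · obtain ⟨i', h₁, h₂, h₃⟩ := inner _ (i + 1) rfl (Nat.succ_pos _) hqi.1
          (by simpa using hqi.2) (fun j hj hij hm => by have := (hi j hj).2 hm; omega)
        refine ⟨i', h₁, h₂, ?_⟩
        rw [← h₃]
        -- The stuttering alternative is impossible at the first occurrence of `p`: the preceding
        -- run position belongs to `L₁` and is strictly before `p`.
        rcases h.step i hqi.1 with h' | h'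
        · have := (hi (i - 1) (by omega)).1 (by omega)
          rw [h'.2.1, hqi.2] at this
          exact absurd (hlt p this) (hirr p)
        · rw [← h'.2, hqi.2]
      · refine ⟨i, hic, fun j hj => ?_, h.gap i hic p (fun h0 => ?_) fun hc => ?_⟩
        · rw [List.mem_append, List.mem_singleton, ← hi j hj]
          refine ⟨Or.inl, fun h' => h'.elim id fun hjp => ?_⟩
          by_contra hij
          rcases h.le htrans (show i ≤ j by omega) hj with h'' | h''
          · have := (hi i (by omega)).2 (hbelow _ (hjp ▸ h''))
            omega
          · exact hqi ⟨by omega, h''.trans hjp⟩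
        · exact hlt _ ((hi (i - 1) (by omega)).1 (by omega))
        · refine habove _ (fun hm => ?_) fun hp => hqi ⟨hc, hp⟩
          have := (hi i hc).2 hm
          omega
  obtain ⟨i, hic, hi, hV⟩ := main L [] (by simp)
  rw [hV]
  rcases hic.lt_or_eq with h' | h'
  · have := (hi i h').2 (hmem _)
    omega
  · rw [h']

/-- If every change of the state increases a measure that is bounded by `c`, then there is a run of
length `c`. -/
theorem exists_isRun (hirr : ∀ x, ¬ r x x) (htrans : ∀ {x y z}, r x y → r y z → r x z)
    {μ : S → ℕ} (hμ : ∀ p s, F p s ≠ s → μ s < μ (F p s)) (hμc : ∀ s, μ s ≤ c) {L : List α}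
    (hL : L.Pairwise r) (hmem : ∀ p, p ∈ L) (p₀ : α) (σ : S) :
    ∃ q V, IsRun r F c q V ∧ V 0 = σ ∧ ∀ i, V (i + 1) = V i ∨ ∃ p, V (i + 1) = F p (V i) := by
  -- First the run of genuine changes, with strictly ordered positions. Each of its `m` changes
  -- raises the measure by at least one, hence the bound on `m + μ σ`, which later gives `m ≤ c`.
  have main : ∃ (m : ℕ) (q : ℕ → α) (V : ℕ → S), V 0 = σ ∧ m + μ σ ≤ μ (V m) ∧
      (∀ i < m, q i ∈ L ∧ F (q i) (V i) = V (i + 1)) ∧ (∀ i, i + 1 < m → r (q i) (q (i + 1))) ∧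
      ∀ i ≤ m, ∀ p ∈ L, (0 < i → r (q (i - 1)) p) → (i < m → r p (q i)) → F p (V i) = V i := by
    -- The induction runs over prefixes of the list, which do not contain all positions.
    clear hmem
    induction L using List.reverseRecOn with
    | nil => exact ⟨0, fun _ => p₀, fun _ => σ, rfl, by simp, by simp, by simp, by simp⟩
    | append_singleton L p ih =>
      rw [List.pairwise_append] at hL
      obtain ⟨hL₁, -, hL₂⟩ := hL
      have hlt : ∀ x ∈ L, r x p := fun x hx => hL₂ x hx p (by simp)
      obtain ⟨m, q, V, h0, hm, hs, hr, hg⟩ := ih hL₁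
      -- If the new position preserves the current state, it joins the last gap; otherwise it is
      -- appended to the run as a change.
      by_cases hp : F p (V m) = V m
      · refine ⟨m, q, V, h0, hm, fun i hi => ⟨List.mem_append_left _ (hs i hi).1, (hs i hi).2⟩, hr,
          fun i hi x hx h₁ h₂ => ?_⟩
        rw [List.mem_append, List.mem_singleton] at hx
        rcases hx with hx | rfl
        · exact hg i hi x hx h₁ h₂
        · rcases hi.lt_or_eq with hi | rfl
          · exact absurd (htrans (h₂ hi) (hlt _ (hs i hi).1)) (hirr x)
          · exact hp
      · have eq : ∀ i < m, Function.update q m p i = q i := fun i hi =>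
          Function.update_of_ne hi.ne _ _
        have eV : ∀ i ≤ m, Function.update V (m + 1) (F p (V m)) i = V i := fun i hi =>
          Function.update_of_ne (by omega) _ _
        refine ⟨m + 1, Function.update q m p, Function.update V (m + 1) (F p (V m)), ?_, ?_, ?_,
          ?_, ?_⟩
        · rw [eV 0 (Nat.zero_le _), h0]
        · rw [Function.update_self]
          have := hμ p (V m) hp
          omega
        · intro i hi
          rcases (Nat.lt_succ_iff.1 hi).lt_or_eq with hi | rfl
          · rw [eq i hi, eV i hi.le, eV (i + 1) hi]
            exact ⟨List.mem_append_left _ (hs i hi).1, (hs i hi).2⟩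
          · rw [eV i le_rfl]
            simp
        · intro i hi
          rw [eq i (by omega)]
          by_cases hi' : i + 1 = m
          · rw [hi', Function.update_self]
            exact hlt _ (hs i (by omega)).1
          · rw [eq (i + 1) (by omega)]
            exact hr i (by omega)
        · intro i hi x hx h₁ h₂
          rw [List.mem_append, List.mem_singleton] at hx
          by_cases hi' : i = m + 1
          · subst hi'
            have h₃ := h₁ (Nat.succ_pos m)
            rw [Nat.add_sub_cancel, Function.update_self] at h₃
            rcases hx with hx | rfl
            · exact absurd (htrans h₃ (hlt x hx)) (hirr p)
            · exact absurd h₃ (hirr x)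
          · rw [eV i (by omega)]
            have h₂' := h₂ (by omega)
            rcases hx with hx | rfl
            · refine hg i (by omega) x hx (fun h0 => ?_) fun hm => ?_
              · have := h₁ h0
                rwa [eq (i - 1) (by omega)] at this
              · rwa [eq i hm] at h₂'
            · by_cases him : i = m
              · subst him
                rw [Function.update_self] at h₂'
                exact absurd h₂' (hirr x)
              · rw [eq i (by omega)] at h₂'
                exact absurd (htrans h₂' (hlt _ (hs i (by omega)).1)) (hirr x)
  obtain ⟨m, q, V, h0, hm, hs, hr, hg⟩ := main
  have hmc : m ≤ c := by
    have := hμc (V m)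
    omega
  -- Padding to length `c`: the last position and the last state are repeated. Without any change
  -- there is no last position, and `p₀` is used.
  refine ⟨fun i => if m = 0 then p₀ else q (min i (m - 1)), fun i => V (min i m),
    ⟨fun i hi => ?_, fun i hi => ?_, fun i hi p h₁ h₂ => ?_⟩, ?_, fun i => ?_⟩
  · split_ifs with hm0
    · exact Or.inr rfl
    · by_cases him : i + 1 < m
      · rw [min_eq_left (by omega), min_eq_left (by omega)]
        exact Or.inl (hr i him)
      · rw [min_eq_right (by omega), min_eq_right (by omega)]
        exact Or.inr rfl
  · by_cases him : i < m
    · right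
      rw [if_neg (by omega), if_neg (by omega), min_eq_left (by omega), min_eq_left (by omega),
        min_eq_left (by omega), min_eq_left (by omega)]
      refine ⟨fun hi0 he => ?_, (hs i him).2⟩
      have := hr (i - 1) (by omega)
      rw [he, Nat.sub_add_cancel hi0] at this
      exact hirr _ this
    · have e₁ : min i m = m := min_eq_right (by omega)
      have e₂ : min (i + 1) m = m := min_eq_right (by omega)
      rw [e₁, e₂]
      by_cases hi0 : 0 < i
      · left
        refine ⟨hi0, ?_, rfl⟩
        rw [min_eq_right (by omega), min_eq_right (by omega)]
      -- Here `i = 0` and `m = 0`: the first step cannot stutter, so it executes `p₀`. No position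
      -- changes the state in this case, as the only gap is the entire word.
      · right
        have hm0 : m = 0 := by omega
        rw [if_pos hm0, if_pos hm0]
        exact ⟨fun h => absurd h hi0, hg m le_rfl p₀ (hmem _) (fun h => by omega)
          fun h => absurd h (lt_irrefl _)⟩
  · refine hg _ (min_le_right _ _) p (hmem p) (fun h => ?_) fun h => ?_
    · have := h₁ (by omega)
      rw [if_neg (by omega)] at this
      rwa [show min i m - 1 = min (i - 1) (m - 1) by omega]
    · have := h₂ (by omega)
      rw [if_neg (by omega)] at this
      rwa [show min i m = min i (m - 1) by omega]
  · simpa using h0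
  · dsimp only
    by_cases him : i < m
    · rw [min_eq_left him.le, min_eq_left (by omega)]
      exact Or.inr ⟨_, (hs i him).2.symm⟩
    · rw [min_eq_right (by omega), min_eq_right (by omega)]
      exact Or.inl rfl

end Runs

/-! ### Accelerated iteration: the formula and its runs -/

namespace PFormula

variable {D : Type u} {A : Finset D} {k n : ℕ}

theorem before_holds {j : ℕ} (d : Dir) (x y : Fin k) (w : List D) (ν : PVar n → Bool)
    (ρ : Fin k → Pos w) (β : Fin j → Bool) :
    (before d x y : BFO A (PVar n) k j).Holds w ν ρ β ↔ d.Before (ρ x) (ρ y) := by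
  cases d <;> rfl

@[simp] theorem outVars_before {j : ℕ} (d : Dir) (x y : Fin k) :
    (before d x y : BFO A (PVar n) k j).outVars = ∅ := by
  cases d <;> rfl

@[simp] theorem qr_before {j : ℕ} (d : Dir) (x y : Fin k) :
    (before d x y : BFO A (PVar n) k j).qr = 0 := by
  cases d <;> rfl

@[simp] theorem outVars_vec (B : Finset (Fin n)) (i : Fin (B.card + 1)) (b : Fin n) :
    (vec B i b).outVars = ∅ := by
  rw [vec]
  split_ifs
  · refine Fin.cases ?_ (fun i => ?_) i <;> rfl
  · rfl

@[simp] theorem outVars_step {k' : ℕ} (Φ : PFormula A (k + 1) n) (f : Fin k → Fin k') (x : Fin k')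
    (i i' : Fin (Φ.outVars.card + 1)) : (step Φ f x i i').outVars = ∅ := by
  ext b
  simp [step, BFO.mem_outVars_subst]

@[simp] theorem qr_step {k' : ℕ} (Φ : PFormula A (k + 1) n) (f : Fin k → Fin k') (x : Fin k')
    (i i' : Fin (Φ.outVars.card + 1)) : (step Φ f x i i').qr = Φ.qr :=
  BFO.qr_subst _ _ _ _

@[simp] theorem outVars_sameVec {k' : ℕ} (B : Finset (Fin n)) (i i' : Fin (B.card + 1)) :
    (sameVec B i i' : BFO A (PVar n) k' _).outVars = ∅ := by
  ext b
  simp [sameVec, BFO.mem_outVars_conj_map, BFO.mem_outVars_iff, BFO.outVars]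

theorem qr_sameVec {k' : ℕ} (B : Finset (Fin n)) (i i' : Fin (B.card + 1)) :
    (sameVec B i i' : BFO A (PVar n) k' _).qr = 0 :=
  Nat.le_zero.1 (BFO.qr_conj_map_le fun _ _ => le_refl 0)

/-- The formula quantifies `c` positions and `c * c` booleans, and the gap condition adds one
universal quantifier above a copy of `Φ`. The test for the empty word has rank `1` and is absorbed.
-/
theorem qr_iter_le (d : Dir) (Φ : PFormula A (k + 1) n) :
    (iter d Φ).qr ≤ Φ.qr + Φ.outVars.card ^ 2 + Φ.outVars.card + 1 := by
  simp only [iter, BFO.qr, BFO.qr_exs, BFO.qr_exBs, qr_idClauses, pow_two]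
  refine max_le (by simp [BFO.top, BFO.qr]) ?_
  have : ∀ l : List (BFO A (PVar n) (k + Φ.outVars.card) (0 + Φ.outVars.card * Φ.outVars.card)),
      (∀ φ ∈ l, φ.qr ≤ Φ.qr + 1) → (BFO.conj l).qr + Φ.outVars.card * Φ.outVars.card +
        Φ.outVars.card ≤ Φ.qr + Φ.outVars.card * Φ.outVars.card + Φ.outVars.card + 1 := by
    intro l hl
    have := BFO.qr_conj_le hl
    omega
  apply this
  simp only [List.forall_mem_cons, List.not_mem_nil, false_imp_iff, implies_true, and_true]
  refine ⟨BFO.qr_conj_map_le fun i _ => BFO.qr_conj_map_le fun i' _ => ?_,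
    BFO.qr_conj_map_le fun i _ => ?_, BFO.qr_conj_map_le fun i _ => ?_,
    BFO.qr_conj_map_le fun b _ => ?_⟩
  · split_ifs <;> simp [BFO.qr, BFO.top]
  · split_ifs <;> simp [BFO.qr, qr_sameVec]
  · simp only [BFO.qr, BFO.qr_imp, qr_step]
    refine Nat.add_le_add_right (max_le (max_le ?_ ?_) le_rfl) 1
    · split_ifs <;> simp [BFO.qr, BFO.top]
    · split_ifs <;> simp [BFO.qr, BFO.top]
  · rw [BFO.qr_iff]
    simp [BFO.qr, out]

/-- In every copy of `Φ` the outputs are replaced by vector entries, which are bound variables or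
inputs. Outputs thus appear only in the identity clauses and in the final clauses, both indexed by
the outputs of `Φ`. -/
theorem outVars_iter (d : Dir) (Φ : PFormula A (k + 1) n) : (iter d Φ).outVars = Φ.outVars := by
  ext b
  simp only [iter, BFO.outVars, BFO.outVars_exs, BFO.outVars_exBs, outVars_idClauses,
    Finset.mem_union, BFO.mem_outVars_conj, List.exists_mem_cons_iff, List.not_mem_nil, false_and,
    exists_false, or_false, outVars_top, Finset.notMem_empty, false_or]
  refine ⟨?_, Or.inl⟩
  rintro (h | h | h | h | h)
  · exact h
  · obtain ⟨i, -, h⟩ := BFO.mem_outVars_conj_map.1 (BFO.mem_outVars_conj.2 h)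
    obtain ⟨i', -, h⟩ := BFO.mem_outVars_conj_map.1 h
    split_ifs at h <;> simp [BFO.outVars] at h
  · obtain ⟨i, -, h⟩ := BFO.mem_outVars_conj_map.1 (BFO.mem_outVars_conj.2 h)
    split_ifs at h <;> simp [BFO.outVars] at h
  · obtain ⟨i, -, h⟩ := BFO.mem_outVars_conj_map.1 (BFO.mem_outVars_conj.2 h)
    simp only [BFO.outVars, BFO.imp, outVars_step, Finset.mem_union, Finset.notMem_empty,
      or_false] at h
    rcases h with h | h <;> split_ifs at h <;> simp at h
  · obtain ⟨i, hi, h⟩ := BFO.mem_outVars_conj_map.1 (BFO.mem_outVars_conj.2 h)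
    rw [mem_elems] at hi
    simp only [BFO.mem_outVars_iff, BFO.outVars, outVars_vec, Finset.notMem_empty, false_or,
      outVars_out, Finset.mem_singleton] at h
    exact h ▸ hi

/-- The values of the vector number `i`. -/
def vecVal (B : Finset (Fin n)) (σ τ : Fin n → Bool) (γ : Fin (B.card * B.card) → Bool)
    (i : Fin (B.card + 1)) (b : Fin n) : Bool :=
  (vec B i b).eval (ioVal σ τ) (boundVals γ)

theorem vecVal_of_notMem {B : Finset (Fin n)} (σ τ : Fin n → Bool)
    (γ : Fin (B.card * B.card) → Bool) (i : Fin (B.card + 1)) {b : Fin n} (hb : b ∉ B) :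
    vecVal B σ τ γ i b = σ b := by
  simp [vecVal, vec, hb, BTerm.eval, ioVal]

theorem vecVal_zero (B : Finset (Fin n)) (σ τ : Fin n → Bool)
    (γ : Fin (B.card * B.card) → Bool) : vecVal B σ τ γ 0 = σ := by
  funext b
  by_cases hb : b ∈ B
  · simp [vecVal, vec, hb, BTerm.eval, ioVal]
  · exact vecVal_of_notMem σ τ γ 0 hb

/-- Any sequence of states that starts in `σ` and agrees with `σ` outside `B` can be stored in the
bound cells. Row `i` of the cells holds `V (i + 1)`, since vector `0` consists of the inputs. -/
theorem exists_vecVal_eq {B : Finset (Fin n)} (σ τ : Fin n → Bool) {V : ℕ → Fin n → Bool}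
    (h0 : V 0 = σ) (hV : ∀ i, ∀ b ∉ B, V i b = σ b) :
    ∃ γ, ∀ i : Fin (B.card + 1), vecVal B σ τ γ i = V i := by
  obtain ⟨δ, hδ⟩ := exists_of_rank B (fun b (i : Fin B.card) => V (i + 1) b)
  refine ⟨fun x => δ (finProdFinEquiv.symm x).2 (finProdFinEquiv.symm x).1, fun i => ?_⟩
  funext b
  by_cases hb : b ∈ B
  · refine Fin.cases ?_ (fun i => ?_) i
    · rw [vecVal_zero]
      exact (congrFun h0 b).symm
    · simp only [vecVal, vec, dif_pos hb, Fin.cases_succ, BTerm.eval, cell, boundVals_natAdd,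
        Equiv.symm_apply_apply, hδ b hb, Fin.val_succ]
  · rw [vecVal_of_notMem _ _ _ _ hb, hV _ b hb]

theorem step_holds {k' : ℕ} (Φ : PFormula A (k + 1) n) (f : Fin k → Fin k') (x : Fin k')
    (i i' : Fin (Φ.outVars.card + 1)) (w : List D) (σ τ : Fin n → Bool) (ρ : Fin k' → Pos w)
    (γ : Fin (Φ.outVars.card * Φ.outVars.card) → Bool) :
    (step Φ f x i i').Holds w (ioVal σ τ) ρ (boundVals γ) ↔
      Φ.Rel w (push (ρ ∘ f) (ρ x)) (vecVal Φ.outVars σ τ γ i) (vecVal Φ.outVars σ τ γ i') := by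
  rw [step, subst_rel, comp_push]
  rfl

theorem sameVec_holds {k' : ℕ} (B : Finset (Fin n)) (i i' : Fin (B.card + 1)) (w : List D)
    (σ τ : Fin n → Bool) (ρ : Fin k' → Pos w) (γ : Fin (B.card * B.card) → Bool) :
    (sameVec B i i' : BFO A (PVar n) k' _).Holds w (ioVal σ τ) ρ (boundVals γ) ↔
      vecVal B σ τ γ i = vecVal B σ τ γ i' := by
  simp only [sameVec, BFO.conj_map_holds, mem_elems, BFO.iff_holds, BFO.Holds, ← Bool.eq_iff_iff]
  refine ⟨fun h => funext fun b => ?_, fun h b _ => congrFun h b⟩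
  by_cases hb : b ∈ B
  · exact h b hb
  · rw [vecVal_of_notMem _ _ _ _ hb, vecVal_of_notMem _ _ _ _ hb]

/-- Exchanges the finite data guessed by the formula for the sequences indexed by `ℕ` used in
`IsRun`. Only indices below `B.card` for positions, and at most `B.card` for states, are compared;
beyond them the default values `p₀` and `σ` serve. -/
theorem exists_vecVal_iff {α : Type*} {B : Finset (Fin n)} {σ τ : Fin n → Bool} (p₀ : α)
    {P : (Fin B.card → α) → (Fin (B.card * B.card) → Bool) → Prop}
    {R : (ℕ → α) → (ℕ → Fin n → Bool) → Prop}
    (h : ∀ q' γ q V, (∀ i, q' i = q i) → (∀ i, vecVal B σ τ γ i = V i) → (P q' γ ↔ R q V)) :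
    (∃ q' γ, P q' γ) ↔
      ∃ q V, R q V ∧ V 0 = σ ∧ ∀ i, ∀ b ∉ B, V i b = σ b := by
  constructor
  · rintro ⟨q', γ, hP⟩
    refine ⟨fun i => if hi : i < B.card then q' ⟨i, hi⟩ else p₀,
      fun i => if hi : i < B.card + 1 then vecVal B σ τ γ ⟨i, hi⟩ else σ,
      (h q' γ _ _ (fun i => by simp) fun i => by rw [dif_pos i.isLt]).1 hP, ?_, fun i b hb => ?_⟩
    · exact (dif_pos (Nat.succ_pos _)).trans <| vecVal_zero B σ τ γ
    · dsimp only
      split_ifs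
      · exact vecVal_of_notMem _ _ _ _ hb
      · rfl
  · rintro ⟨q, V, hR, h0, hV⟩
    obtain ⟨γ, hγ⟩ := exists_vecVal_eq σ τ h0 hV
    exact ⟨fun i => q i, γ, (h _ γ q V (fun _ => rfl) hγ).2 hR⟩

/-- The accelerated iteration on a nonempty word, if `Φ(p)` describes `F p`, says that there is a
run from the input to the output. -/
theorem iter_rel (d : Dir) {Φ : PFormula A (k + 1) n} {w : List D} {ρ : Fin k → Pos w}
    {F : Pos w → (Fin n → Bool) → (Fin n → Bool)}
    (hF : ∀ p, Φ.Describes w (push ρ p) (F p)) (p₀ : Pos w) (σ τ : Fin n → Bool) :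
    (iter d Φ).Rel w ρ σ τ ↔ ∃ (q : ℕ → Pos w) (V : ℕ → Fin n → Bool),
      (IsRun d.Before F Φ.outVars.card q V ∧ ∀ b ∈ Φ.outVars, τ b = V Φ.outVars.card b) ∧
      V 0 = σ ∧ ∀ i, ∀ b ∉ Φ.outVars, V i b = σ b := by
  -- `Rel` constrains only the outputs of `Φ`. All vectors agree with `σ` elsewhere and `F p`
  -- changes nothing there, so the constraint becomes an equality of whole states.
  have hrel : ∀ p γ i i', Φ.Rel w (push ρ p) (vecVal Φ.outVars σ τ γ i)
      (vecVal Φ.outVars σ τ γ i') ↔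
        F p (vecVal Φ.outVars σ τ γ i) = vecVal Φ.outVars σ τ γ i' := by
    intro p γ i i'
    rw [(hF p).1]
    refine ⟨fun h => funext fun b => ?_, fun h b _ => (congrFun h b).symm⟩
    by_cases hb : b ∈ Φ.outVars
    · exact (h b hb).symm
    · rw [(hF p).2 _ b hb, vecVal_of_notMem _ _ _ _ hb, vecVal_of_notMem _ _ _ _ hb]
  rw [rel_iff_holds, iter]
  -- The position `p₀` refutes the disjunct for the empty word.
  refine (or_iff_right fun h => h.1 ⟨p₀, rfl⟩).trans ?_
  simp only [BFO.exs_holds, BFO.exBs_holds_zero]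
  refine exists_vecVal_iff (τ := τ) p₀ fun q' γ q V hq hV => ?_
  rw [BFO.conj_holds]
  simp only [List.forall_mem_cons, List.not_mem_nil, false_imp_iff, implies_true, and_true]
  refine (and_congr ?_ (and_congr ?_ (and_congr ?_ ?_))).trans
    ⟨fun h => ⟨⟨h.1, h.2.1, h.2.2.1⟩, h.2.2.2⟩, fun h => ⟨h.1.mono, h.1.step, h.1.gap, h.2⟩⟩
  · simp only [BFO.conj_map_holds, List.mem_finRange, true_imp_iff]
    constructor
    · intro h i hi
      have := h ⟨i, by omega⟩ ⟨i + 1, hi⟩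
      rw [if_pos rfl] at this
      simpa only [BFO.Holds, before_holds, Fin.append_right, hq] using this
    · intro h i i'
      split_ifs with e
      · simp only [BFO.Holds, before_holds, Fin.append_right, hq]
        have := h i (by omega)
        rwa [e] at this
      · exact BFO.top_holds _ _ _ _
  · have hstep : ∀ (i : Fin Φ.outVars.card), (step Φ (Fin.castAdd Φ.outVars.card) (Fin.natAdd k i)
        i.castSucc i.succ).Holds w (ioVal σ τ) (Fin.append ρ q') (boundVals γ) ↔
          F (q i) (V i) = V (i + 1) := by
      intro i
      rw [step_holds, append_castAdd_comp, Fin.append_right, hq, hrel, hV, hV]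
      rfl
    have hall : ∀ P : ℕ → Prop, (∀ i < Φ.outVars.card, P i) ↔ ∀ i : Fin Φ.outVars.card, P i :=
      fun P => ⟨fun h i => h i i.isLt, fun h i hi => h ⟨i, hi⟩⟩
    rw [BFO.conj_map_holds, hall]
    simp only [List.mem_finRange, true_imp_iff]
    refine forall_congr' fun i => ?_
    by_cases h0 : i.val = 0
    · rw [dif_pos h0, hstep]
      simp [h0]
    · rw [dif_neg h0]
      simp only [BFO.Holds, hstep, sameVec_holds, Fin.append_right, hq, hV]
      simp [Nat.pos_of_ne_zero h0]
  · have hall : ∀ P : ℕ → Prop,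
        (∀ i ≤ Φ.outVars.card, P i) ↔ ∀ i : Fin (Φ.outVars.card + 1), P i :=
      fun P => ⟨fun h i => h i (Nat.lt_succ_iff.1 i.isLt), fun h i hi => h ⟨i, Nat.lt_succ_of_le hi⟩⟩
    rw [BFO.conj_map_holds, hall]
    simp only [List.mem_finRange, true_imp_iff]
    refine forall_congr' fun i => ?_
    simp only [BFO.Holds, BFO.imp_holds]
    refine forall_congr' fun p => ?_
    rw [and_imp]
    refine imp_congr ?_ (imp_congr ?_ ?_)
    · by_cases h0 : i.val = 0
      · rw [dif_pos h0]
        simp [BFO.top_holds, h0]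
      · rw [dif_neg h0, before_holds, push_castSucc, push_last, Fin.append_right, hq]
        simp [Nat.pos_of_ne_zero h0]
    · by_cases hc : i.val < Φ.outVars.card
      · rw [dif_pos hc, before_holds, push_castSucc, push_last, Fin.append_right, hq]
        simp [hc]
      · rw [dif_neg hc]
        simp [BFO.top_holds, hc]
    · rw [step_holds, push_last]
      have : push (Fin.append ρ q') p ∘ (fun x => (Fin.castAdd Φ.outVars.card x).castSucc) = ρ := by
        funext x
        simp
      rw [this, hrel, hV]
  · simp only [BFO.conj_map_holds, mem_elems, BFO.iff_holds]
    refine forall₂_congr fun b _ => ?_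
    have : (vec Φ.outVars (Fin.last Φ.outVars.card) b).eval (ioVal σ τ) (boundVals γ) =
        V Φ.outVars.card b := congrFun (hV (Fin.last _)) b
    simp only [BFO.Holds, this]
    simp only [out, BFO.Holds, BTerm.eval, ioVal, ← Bool.eq_iff_iff]
    exact eq_comm

/-- A run reaches the result of the fold, whether or not the maps are monotone. Monotonicity is
needed for the existence of a run: it makes the number of true output variables a measure that grows
at each change and is bounded by their number. -/
theorem iter_describes (d : Dir) {Φ : PFormula A (k + 1) n} {w : List D} {ρ : Fin k → Pos w}
    {F : Pos w → (Fin n → Bool) → (Fin n → Bool)}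
    (hF : ∀ p, Φ.Describes w (push ρ p) (F p)) (hmono : ∀ p σ b, σ b = true → F p σ b = true) :
    (iter d Φ).Describes w ρ (fun σ => (d.positions w).foldl (fun σ' p => F p σ') σ) := by
  refine ⟨fun σ τ => ?_, fun σ b hb => ?_⟩
  · rw [outVars_iter]
    rcases isEmpty_or_nonempty (Pos w) with he | ⟨⟨p₀⟩⟩
    · have hL : d.positions w = [] :=
        List.eq_nil_iff_forall_not_mem.2 fun p _ => he.elim p
      rw [rel_iff_holds, iter, hL]
      simp only [BFO.Holds, BFO.exs_holds, idClauses_holds, IsEmpty.exists_iff, not_false_iff,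
        true_and, List.foldl_nil]
      -- In the empty word the second disjunct can hold only if no position has to be guessed; then
      -- there are no output variables and the identity clauses are vacuous.
      refine or_iff_left_of_imp ?_
      rintro ⟨q, -⟩ b hb
      exact he.elim (q ⟨0, Finset.card_pos.2 ⟨b, hb⟩⟩)
    · rw [iter_rel d hF p₀]
      have hirr := Dir.Before.irrefl d (N := w.length)
      constructor
      · rintro ⟨q, V, ⟨h, hτ⟩, rfl, -⟩
        intro b hb
        rw [hτ b hb, ← h.foldl_eq hirr Dir.Before.trans (d.pairwise_positions w)
          (d.mem_positions w)]
      · intro hτ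
        have hμ : ∀ p s, F p s ≠ s → (Φ.outVars.filter fun b => s b = true).card <
            (Φ.outVars.filter fun b => F p s b = true).card := by
          intro p s hs
          obtain ⟨b, hb⟩ := Function.ne_iff.1 hs
          have hs' : s b = false := by
            by_contra hsb
            rw [Bool.not_eq_false] at hsb
            exact hb ((hmono p s b hsb).trans hsb.symm)
          refine Finset.card_lt_card ⟨fun x hx => ?_, fun hsub => ?_⟩
          · rw [Finset.mem_filter] at hx ⊢
            exact ⟨hx.1, hmono p s x hx.2⟩
          · have hbo : b ∈ Φ.outVars := by
              by_contra hbo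
              exact hb ((hF p).2 s b hbo)
            have := hsub (Finset.mem_filter.2 ⟨hbo, by rw [hs'] at hb; simpa using hb⟩)
            rw [Finset.mem_filter, hs'] at this
            exact Bool.false_ne_true this.2
        obtain ⟨q, V, h, h0, hV⟩ := exists_isRun (r := d.Before) (F := F) (c := Φ.outVars.card)
          (μ := fun s => (Φ.outVars.filter fun b => s b = true).card) hirr Dir.Before.trans
          hμ (fun s => Finset.card_filter_le _ _) (d.pairwise_positions w)
          (d.mem_positions w) p₀ σ
        refine ⟨q, V, ⟨h, fun b hb => ?_⟩, h0, fun i => ?_⟩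
        · rw [hτ b hb, ← h.foldl_eq hirr Dir.Before.trans (d.pairwise_positions w)
            (d.mem_positions w), h0]
        -- Each state of the run equals its predecessor or is its image under some `F p`, so
        -- variables outside the outputs of `Φ` keep their initial values.
        · induction i with
          | zero => exact fun b _ => congrFun h0 b
          | succ i ih =>
            intro b hb
            rcases hV i with h' | ⟨p, h'⟩
            · rw [h', ih b hb]
            · rw [h', (hF p).2 _ b hb, ih b hb]
  · rw [outVars_iter] at hb
    induction d.positions w generalizing σ with
    | nil => rfl
    | cons p L ih =>
      exact (ih _).trans ((hF p).2 σ b hb)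

end PFormula

instance Dir.decidableBefore {N : ℕ} : (d : Dir) → (i j : Fin N) → Decidable (d.Before i j)
  | .fwd, i, j => inferInstanceAs (Decidable (i < j))
  | .bwd, i, j => inferInstanceAs (Decidable (j < i))

/-- The state in which a loop, started in the state `σ`, visits the position `p`. -/
def stateBefore {D : Type u} {S : Type*} (d : Dir) (w : List D) (F : Pos w → S → S) (σ : S)
    (p : Pos w) : S :=
  (d.positions w).foldl (fun s j => if d.Before j p then F j s else s) σ

/-- The list is sorted, so the fold guarded by `r j p` applies precisely the maps of the positions
before `p` and yields the state in which `p` is visited. This separates the evolution of the state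
from the output and makes each iteration's output independently describable. -/
theorem foldl_append_eq_flatMap {α S E : Type*} {r : α → α → Prop} [DecidableRel r]
    (hirr : ∀ x, ¬ r x x) (htrans : ∀ {x y z}, r x y → r y z → r x z) (F : α → S → S)
    (g : α → S → List E) (σ : S) {L : List α} (hL : L.Pairwise r) :
    L.foldl (fun st p => (F p st.1, st.2 ++ g p st.1)) (σ, []) =
      (L.foldl (fun s p => F p s) σ,
        L.flatMap fun p => g p (L.foldl (fun s j => if r j p then F j s else s) σ)) := by
  induction L using List.reverseRecOn with
  | nil => rfl
  | append_singleton L p ih =>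
    rw [List.pairwise_append] at hL
    obtain ⟨hL₁, -, hL₂⟩ := hL
    have hlt : ∀ x ∈ L, r x p := fun x hx => hL₂ x hx p (by simp)
    have h₁ : ∀ x ∈ L, (L ++ [p]).foldl (fun s j => if r j x then F j s else s) σ =
        L.foldl (fun s j => if r j x then F j s else s) σ := by
      intro x hx
      rw [List.foldl_append, List.foldl_cons, List.foldl_nil,
        if_neg fun h => hirr p (htrans h (hlt x hx))]
    have h₂ : (L ++ [p]).foldl (fun s j => if r j p then F j s else s) σ =
        L.foldl (fun s p => F p s) σ := by
      rw [List.foldl_append, List.foldl_cons, List.foldl_nil, if_neg (hirr p)]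
      refine List.foldl_ext _ _ _ fun s x hx => ?_
      rw [if_pos (hlt x hx)]
    rw [List.foldl_append, ih hL₁, List.flatMap_append, List.flatMap_singleton, h₂]
    simp only [List.foldl_append, List.foldl_cons, List.foldl_nil, Prod.mk.injEq, true_and]
    congr 1
    refine List.flatMap_congr fun x hx => ?_
    have := h₁ x hx
    simp only [List.foldl_append, List.foldl_cons, List.foldl_nil] at this
    rw [this]

/-! ### Program formulas of conditions and statements -/

section Statements

variable {D : Type u} {A : Finset D}

theorem BExpr.outVars_toFormula {k n : ℕ} : ∀ e : BExpr A k n, BFO.outVars e.toFormula = ∅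
  | .const _ => rfl
  | .not e => e.outVars_toFormula
  | .bin op e₁ e₂ => by
      cases op <;>
        simp [toFormula, BFO.iff, BFO.imp, BFO.outVars, e₁.outVars_toFormula, e₂.outVars_toFormula]
  | .var _ => rfl
  | .cmp op _ _ => by cases op <;> rfl
  | .labelEq _ _ => rfl

variable [DecidableEq D]

theorem BExpr.toFormula_rel {k n : ℕ} (w : List D) (ρ : Fin k → Pos w) (σ τ : Fin n → Bool) :
    ∀ e : BExpr A k n, PFormula.Rel e.toFormula w ρ σ τ ↔ e.eval w ρ σ = true
  | .const _ => Iff.rfl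
  | .not e => by
      have := e.toFormula_rel w ρ σ τ
      rw [PFormula.rel_iff_holds] at this ⊢
      simp [toFormula, BFO.Holds, this, eval]
  | .bin op e₁ e₂ => by
      have h₁ := e₁.toFormula_rel w ρ σ τ
      have h₂ := e₂.toFormula_rel w ρ σ τ
      rw [PFormula.rel_iff_holds] at h₁ h₂ ⊢
      cases op <;>
        simp only [toFormula, BFO.Holds, BFO.iff_holds, BFO.imp_holds, h₁, h₂, eval, BinOp.eval] <;>
        cases e₁.eval w ρ σ <;> cases e₂.eval w ρ σ <;> simp
  | .var _ => Iff.rfl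
  | .cmp op i j => by
      rw [PFormula.rel_iff_holds]
      cases op <;> simp [toFormula, BFO.Holds, eval, CmpOp.eval]
  | .labelEq _ _ => by
      rw [PFormula.rel_iff_holds]
      simp [toFormula, BFO.Holds, eval]

/-- The effect of the body of a loop on the variables that are declared outside. -/
def Stmt.loopStep {k n m : ℕ} (body : Stmt A (k + 1) (n + m)) (w : List D) (ρ : Fin k → Pos w)
    (p : Pos w) (σ : Fin n → Bool) : Fin n → Bool :=
  fun b => (body.exec w (push ρ p) (Fin.append σ fun _ => false)).1 (Fin.castAdd m b)

theorem Stmt.exec_loop {k n m : ℕ} (d : Dir) (body : Stmt A (k + 1) (n + m)) (w : List D)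
    (ρ : Fin k → Pos w) (σ : Fin n → Bool) :
    (Stmt.loop d m body).exec w ρ σ =
      ((d.positions w).foldl (fun s p => body.loopStep w ρ p s) σ,
        (d.positions w).flatMap fun p => (body.exec w (push ρ p)
          (Fin.append (stateBefore d w (body.loopStep w ρ) σ p) fun _ => false)).2) := by
  rw [exec]
  exact foldl_append_eq_flatMap (r := d.Before) (Dir.Before.irrefl d) Dir.Before.trans
    (body.loopStep w ρ) (fun p s => (body.exec w (push ρ p) (Fin.append s fun _ => false)).2) σ
    (d.pairwise_positions w)

/-- The only assignment sets a variable to true. Resetting the local variables of a loop does not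
affect the variables of the outer scope. -/
theorem Stmt.exec_mono (w : List D) : ∀ {k n : ℕ} (s : Stmt A k n) (ρ : Fin k → Pos w)
    (σ : Fin n → Bool) (b : Fin n), σ b = true → (s.exec w ρ σ).1 b = true
  | _, _, .skip, _, _, _, h => h
  | _, _, .setTrue b', _, σ, b, h => by
      rw [exec]
      by_cases hb : b = b'
      · simp [hb]
      · simpa [hb] using h
  | _, _, .printConst _, _, _, _, h => h
  | _, _, .printLabel _, _, _, _, h => h
  | _, _, .ite e s₁ s₂, ρ, σ, b, h => by
      rw [exec]
      split_ifs
      · exact s₁.exec_mono w ρ σ b h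
      · exact s₂.exec_mono w ρ σ b h
  | _, _, .seq s₁ s₂, ρ, σ, b, h => s₂.exec_mono w ρ _ b (s₁.exec_mono w ρ σ b h)
  | _, _, .loop d m body, ρ, σ, b, h => by
      rw [exec_loop]
      dsimp only
      induction d.positions w generalizing σ with
      | nil => exact h
      | cons p L ih =>
        refine ih _ (body.exec_mono w _ _ _ ?_)
        rwa [Fin.append_left]

theorem Stmt.loopStep_mono {k n m : ℕ} (body : Stmt A (k + 1) (n + m)) (w : List D)
    (ρ : Fin k → Pos w) (p : Pos w) (σ : Fin n → Bool) (b : Fin n) (h : σ b = true) :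
    body.loopStep w ρ p σ b = true :=
  body.exec_mono w _ _ _ (by rwa [Fin.append_left])

theorem Stmt.toFormula_describes (w : List D) : ∀ {k n : ℕ} (s : Stmt A k n) (ρ : Fin k → Pos w),
    PFormula.Describes s.toFormula w ρ (fun σ => (s.exec w ρ σ).1)
  | _, _, .skip, ρ => PFormula.describes_top w ρ
  | _, _, .setTrue b, ρ => by
      refine ⟨fun σ τ => ?_, fun σ b' hb => ?_⟩
      · rw [PFormula.rel_iff_holds]
        simp [toFormula, BFO.Holds, out, BFO.outVars, BTerm.outVars, exec, BTerm.eval, ioVal]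
      · simp only [toFormula, outVars_out, Finset.mem_singleton] at hb
        simp [exec, hb]
  | _, _, .printConst _, ρ => PFormula.describes_top w ρ
  | _, _, .printLabel _, ρ => PFormula.describes_top w ρ
  | _, _, .ite e s₁ s₂, ρ => by
      have := PFormula.branch_describes e.outVars_toFormula (fun σ τ => e.toFormula_rel w ρ σ τ)
        (s₁.toFormula_describes w ρ) (s₂.toFormula_describes w ρ)
      have h : (fun σ => ((Stmt.ite e s₁ s₂).exec w ρ σ).1) =
          fun σ => if e.eval w ρ σ = true then (s₁.exec w ρ σ).1 else (s₂.exec w ρ σ).1 := by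
        funext σ
        rw [exec]
        split_ifs <;> rfl
      rw [h]
      exact this
  | _, _, .seq s₁ s₂, ρ =>
      PFormula.comp_describes (s₁.toFormula_describes w ρ) (s₂.toFormula_describes w ρ)
  | _, _, .loop d m body, ρ => by
      have := PFormula.iter_describes d (F := body.loopStep w ρ)
        (fun p => PFormula.closeLocals_describes (body.toFormula_describes w (push ρ p)))
        (body.loopStep_mono w ρ)
      simp only [exec_loop]
      exact this

end Statements

namespace PFormula

variable {D : Type u} {A : Finset D} {k n : ℕ}

/-- The guarded body applies `F j` if `j` is visited before `i` and the identity otherwise, so it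
stays monotone and `iter_describes` applies. In the extended scope the variable `k` is the fixed
position `i` and the variable `k + 1` is the scanned position `j`; the renaming makes `Φ` read `j`
and skip `i`. -/
theorem iterBefore_describes (d : Dir) {Φ : PFormula A (k + 1) n} {w : List D} {ρ : Fin k → Pos w}
    {F : Pos w → (Fin n → Bool) → (Fin n → Bool)}
    (hF : ∀ p, Φ.Describes w (push ρ p) (F p)) (hmono : ∀ p σ b, σ b = true → F p σ b = true)
    (i : Pos w) :
    (iterBefore d Φ).Describes w (push ρ i) (fun σ => stateBefore d w F σ i) := by
  refine iter_describes d (F := fun j s => if d.Before j i then F j s else s) (fun p => ?_)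
    fun p σ b h => ?_
  · have h₁ : Describes (Φ.rename (push (fun x => x.castSucc.castSucc) (Fin.last (k + 1)))) w
        (push (push ρ i) p) (F p) := by
      refine Describes.rename ?_
      rw [comp_push, push_last]
      convert hF p using 2
      funext x
      simp
    have := branch_describes (outVars_before d (Fin.last (k + 1)) (Fin.last k).castSucc)
      (c := fun _ => decide (d.Before p i)) (fun σ τ => ?_) h₁
      (describes_top w (push (push ρ i) p))
    · simpa using this
    · rw [rel_iff_holds, before_holds]
      simp
  · split_ifs
    · exact hmono p σ b h
    · exact h

end PFormula

open FirstOrder.Language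

/-! ### Word formulas and elimination of the boolean sort -/

section Formulas

variable {D : Type u} {A : Finset D} {k : ℕ} (w : List D)

namespace WordFormula

theorem holds_eqV (i j : Fin k) (x : Fin k → Pos w) :
    (eqV i j : WordFormula A k).Holds w x ↔ x i = x j := by
  let := wordStructure A w
  exact BoundedFormula.realize_bdEqual _ _

theorem holds_ltV (i j : Fin k) (x : Fin k → Pos w) :
    (ltV i j : WordFormula A k).Holds w x ↔ x i < x j := by
  let := wordStructure A w
  exact Iff.rfl

theorem holds_labelV (i : Fin k) (a : A) (x : Fin k → Pos w) :
    (labelV i a : WordFormula A k).Holds w x ↔ w.get (x i) = (a : D) := by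
  let := wordStructure A w
  exact Iff.rfl

theorem holds_top (x : Fin k → Pos w) : (⊤ : WordFormula A k).Holds w x := by
  let := wordStructure A w
  exact BoundedFormula.realize_top.2 trivial

theorem not_holds_bot (x : Fin k → Pos w) : ¬ (⊥ : WordFormula A k).Holds w x := id

theorem holds_inf (φ ψ : WordFormula A k) (x : Fin k → Pos w) :
    Holds (φ ⊓ ψ) w x ↔ φ.Holds w x ∧ ψ.Holds w x := by
  let := wordStructure A w
  exact BoundedFormula.realize_inf

theorem holds_sup (φ ψ : WordFormula A k) (x : Fin k → Pos w) :
    Holds (φ ⊔ ψ) w x ↔ φ.Holds w x ∨ ψ.Holds w x := by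
  let := wordStructure A w
  exact BoundedFormula.realize_sup

theorem holds_all (φ : WordFormula A (k + 1)) (x : Fin k → Pos w) :
    Holds (BoundedFormula.all φ) w x ↔ ∀ p, φ.Holds w (push x p) := Iff.rfl

theorem holds_ex (φ : WordFormula A (k + 1)) (x : Fin k → Pos w) :
    Holds (BoundedFormula.ex φ) w x ↔ ∃ p, φ.Holds w (push x p) := by
  let := wordStructure A w
  exact BoundedFormula.realize_ex

theorem holds_lexV (d : Dir) (i j : Fin k) (φ : WordFormula A k) (x : Fin k → Pos w) :
    (lexV d i j φ).Holds w x ↔ d.Before (x i) (x j) ∨ x i = x j ∧ φ.Holds w x := by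
  refine (holds_sup w _ _ x).trans (or_congr ?_ ?_)
  · cases d <;> exact Iff.rfl
  · rw [holds_inf, holds_eqV]

theorem isQF_lexV (d : Dir) (i j : Fin k) {φ : WordFormula A k} (h : φ.IsQF) :
    (lexV d i j φ).IsQF := by
  refine BoundedFormula.IsQF.sup ?_ (BoundedFormula.IsQF.inf ?_ h)
  · cases d <;> exact (BoundedFormula.IsAtomic.rel _ _).isQF
  · exact (BoundedFormula.IsAtomic.equal _ _).isQF

end WordFormula

/-- The elimination of the boolean sort is correct. -/
theorem BFO.toWord_holds {V : Type} (ν : V → Bool) : ∀ {k j : ℕ} (φ : BFO A V k j)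
    (ρ : Fin k → Pos w) (β : Fin j → Bool), (φ.toWord ν β).Holds w ρ ↔ φ.Holds w ν ρ β
  | _, _, eq x y, ρ, _ => WordFormula.holds_eqV w x y ρ
  | _, _, lt x y, ρ, _ => WordFormula.holds_ltV w x y ρ
  | _, _, label x a, ρ, _ => WordFormula.holds_labelV w x a ρ
  | _, _, bool t, ρ, β => by
      rw [toWord, Holds]
      split_ifs with h
      · exact iff_of_true (WordFormula.holds_top w ρ) h
      · exact iff_of_false (WordFormula.not_holds_bot w ρ) h
  | _, _, not φ, ρ, β => not_congr (toWord_holds ν φ ρ β)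
  | _, _, and φ ψ, ρ, β =>
      (WordFormula.holds_inf w _ _ ρ).trans
        (and_congr (toWord_holds ν φ ρ β) (toWord_holds ν ψ ρ β))
  | _, _, or φ ψ, ρ, β =>
      (WordFormula.holds_sup w _ _ ρ).trans
        (or_congr (toWord_holds ν φ ρ β) (toWord_holds ν ψ ρ β))
  | _, _, all φ, ρ, β =>
      (WordFormula.holds_all w _ ρ).trans (forall_congr' fun p => toWord_holds ν φ (push ρ p) β)
  | _, _, ex φ, ρ, β =>
      (WordFormula.holds_ex w _ ρ).trans (exists_congr fun p => toWord_holds ν φ (push ρ p) β)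
  | _, _, allB φ, ρ, β => by
      rw [toWord, Holds, WordFormula.holds_inf, toWord_holds ν φ, toWord_holds ν φ, Bool.forall_bool]
      exact and_comm
  | _, _, exB φ, ρ, β => by
      rw [toWord, Holds, WordFormula.holds_sup, toWord_holds ν φ, toWord_holds ν φ, Bool.exists_bool]
      exact or_comm

theorem Stmt.isQF_ordFormula : ∀ {k n : ℕ} (s : Stmt A k n) (t t' : s.Print),
    (s.ordFormula t t').IsQF
  | _, _, .skip, t, _ => Empty.elim t
  | _, _, .setTrue _, t, _ => Empty.elim t
  | _, _, .printConst _, _, _ => BoundedFormula.IsQF.top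
  | _, _, .printLabel _, _, _ => BoundedFormula.IsQF.top
  | _, _, .ite e s₁ s₂, t, t' => by
      rcases t with t | t <;> rcases t' with t' | t'
      · exact s₁.isQF_ordFormula t t'
      · exact BoundedFormula.IsQF.top
      · exact BoundedFormula.isQF_bot
      · exact s₂.isQF_ordFormula t t'
  | _, _, .seq s₁ s₂, t, t' => by
      rcases t with t | t <;> rcases t' with t' | t'
      · exact s₁.isQF_ordFormula t t'
      · exact BoundedFormula.IsQF.top
      · exact BoundedFormula.isQF_bot
      · exact s₂.isQF_ordFormula t t'
  | _, _, .loop d _ body, t, t' => WordFormula.isQF_lexV d _ _ (body.isQF_ordFormula t t')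

end Formulas

/-! ### Print events -/

namespace Stmt

variable {D : Type u} {A : Finset D}

/-- A print statement with values for the position variables in its scope. -/
abbrev Event {k n : ℕ} (s : Stmt A k n) (w : List D) : Type := Σ t : s.Print, (Fin (s.ar t) → Pos w)

/-- A constant, or the label of a position. -/
def readLetter {k : ℕ} (w : List D) (q : Fin k → Pos w) : A ⊕ Fin k → D
  | .inl a => (a : D)
  | .inr i => w.get (q i)

/-- The letter printed by an event. -/
def letter {k n : ℕ} (s : Stmt A k n) (w : List D) (e : s.Event w) : D :=
  readLetter w e.2 (s.outLetter e.1)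

/-- The values of the outer position variables. -/
def outer {k n : ℕ} (s : Stmt A k n) {w : List D} (e : s.Event w) : Fin k → Pos w :=
  e.2 ∘ Fin.castLE (s.le_ar e.1)

/-- The order on events that is defined by the order formulas. -/
def EventLE {k n : ℕ} (s : Stmt A k n) (w : List D) (e e' : s.Event w) : Prop :=
  (s.ordFormula e.1 e'.1).Holds w (Fin.append e.2 e'.2)

section Loop

variable {k n m : ℕ} (d : Dir) (body : Stmt A (k + 1) (n + m)) (w : List D)

/-- The position of the outermost loop variable. -/
def loopPos (e : body.Event w) : Pos w := body.outer e (Fin.last k)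

theorem outer_loop (e : body.Event w) :
    outer (Stmt.loop (n := n) d m body) (w := w) e = body.outer e ∘ Fin.castSucc := rfl

/-- An event of a loop is an event of its body; the values outside the body are those outside the
loop together with the position of the loop variable. This drives the inductions through loops. -/
theorem outer_body (e : body.Event w) :
    body.outer e = push (outer (Stmt.loop (n := n) d m body) (w := w) e) (body.loopPos w e) := by
  rw [outer_loop]
  funext i
  refine Fin.lastCases ?_ (fun i => ?_) i
  · simp [loopPos]
  · simp

theorem outer_eq_of_loop {e e' : body.Event w}
    (h : outer (Stmt.loop (n := n) d m body) (w := w) e =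
      outer (Stmt.loop (n := n) d m body) (w := w) e')
    (h' : body.loopPos w e = body.loopPos w e') : body.outer e = body.outer e' := by
  rw [outer_body d, outer_body d body w e', h, h']

theorem eventLE_loop (e e' : body.Event w) :
    EventLE (Stmt.loop (n := n) d m body) w e e' ↔ d.Before (body.loopPos w e) (body.loopPos w e') ∨
      body.loopPos w e = body.loopPos w e' ∧ body.EventLE w e e' := by
  refine (WordFormula.holds_lexV w d _ _ _ _).trans ?_
  have h₁ : Fin.append e.2 e'.2 (Fin.castAdd (body.ar e'.1) ⟨k, body.le_ar e.1⟩) =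
      body.loopPos w e := Fin.append_left _ _ _
  have h₂ : Fin.append e.2 e'.2 (Fin.natAdd (body.ar e.1) ⟨k, body.le_ar e'.1⟩) =
      body.loopPos w e' := Fin.append_right _ _ _
  rw [← h₁, ← h₂]
  exact Iff.rfl

end Loop

/-- The order formulas of `s` compare only loop variables bound inside `s`, so comparability is
claimed for events with equal outer positions. For the body of a loop this equality is available
exactly when the loop positions coincide. The same restriction is needed for antisymmetry. -/
theorem eventLE_total (w : List D) : ∀ {k n : ℕ} (s : Stmt A k n) (e e' : s.Event w),
    s.outer e = s.outer e' → s.EventLE w e e' ∨ s.EventLE w e' e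
  | _, _, .skip, e, _, _ => Empty.elim e.1
  | _, _, .setTrue _, e, _, _ => Empty.elim e.1
  | _, _, .printConst _, _, _, _ => Or.inl (WordFormula.holds_top w _)
  | _, _, .printLabel _, _, _, _ => Or.inl (WordFormula.holds_top w _)
  | _, _, .ite e s₁ s₂, ⟨t, q⟩, ⟨t', q'⟩, h => by
      rcases t with t | t <;> rcases t' with t' | t'
      · exact s₁.eventLE_total w ⟨t, q⟩ ⟨t', q'⟩ h
      · exact Or.inl (WordFormula.holds_top w _)
      · exact Or.inr (WordFormula.holds_top w _)
      · exact s₂.eventLE_total w ⟨t, q⟩ ⟨t', q'⟩ h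
  | _, _, .seq s₁ s₂, ⟨t, q⟩, ⟨t', q'⟩, h => by
      rcases t with t | t <;> rcases t' with t' | t'
      · exact s₁.eventLE_total w ⟨t, q⟩ ⟨t', q'⟩ h
      · exact Or.inl (WordFormula.holds_top w _)
      · exact Or.inr (WordFormula.holds_top w _)
      · exact s₂.eventLE_total w ⟨t, q⟩ ⟨t', q'⟩ h
  | _, _, .loop d m body, e, e', h => by
      refine (or_congr (eventLE_loop d body w e e') (eventLE_loop d body w e' e)).2 ?_
      rcases Dir.Before.trichotomy d (body.loopPos w e) (body.loopPos w e') with h' | h' | h'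
      · exact Or.inl (Or.inl h')
      · have := body.eventLE_total w e e' (outer_eq_of_loop d body w h h')
        exact this.imp (fun h'' => Or.inr ⟨h', h''⟩) (fun h'' => Or.inr ⟨h'.symm, h''⟩)
      · exact Or.inr (Or.inl h')

theorem eventLE_antisymm (w : List D) : ∀ {k n : ℕ} (s : Stmt A k n) (e e' : s.Event w),
    s.outer e = s.outer e' → s.EventLE w e e' → s.EventLE w e' e → e = e'
  | _, _, .skip, e, _, _, _, _ => Empty.elim e.1
  | _, _, .setTrue _, e, _, _, _, _ => Empty.elim e.1
  | _, _, .printConst _, ⟨_, _⟩, ⟨_, _⟩, h, _, _ => Sigma.ext rfl (heq_of_eq h)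
  | _, _, .printLabel _, ⟨_, _⟩, ⟨_, _⟩, h, _, _ => Sigma.ext rfl (heq_of_eq h)
  | _, _, .ite e s₁ s₂, ⟨t, q⟩, ⟨t', q'⟩, h, h₁, h₂ => by
      rcases t with t | t <;> rcases t' with t' | t'
      · cases s₁.eventLE_antisymm w ⟨t, q⟩ ⟨t', q'⟩ h h₁ h₂
        rfl
      · exact (WordFormula.not_holds_bot w _ h₂).elim
      · exact (WordFormula.not_holds_bot w _ h₁).elim
      · cases s₂.eventLE_antisymm w ⟨t, q⟩ ⟨t', q'⟩ h h₁ h₂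
        rfl
  | _, _, .seq s₁ s₂, ⟨t, q⟩, ⟨t', q'⟩, h, h₁, h₂ => by
      rcases t with t | t <;> rcases t' with t' | t'
      · cases s₁.eventLE_antisymm w ⟨t, q⟩ ⟨t', q'⟩ h h₁ h₂
        rfl
      · exact (WordFormula.not_holds_bot w _ h₂).elim
      · exact (WordFormula.not_holds_bot w _ h₁).elim
      · cases s₂.eventLE_antisymm w ⟨t, q⟩ ⟨t', q'⟩ h h₁ h₂
        rfl
  | _, _, .loop d m body, e, e', h, h₁, h₂ => by
      replace h₁ := (eventLE_loop d body w e e').1 h₁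
      replace h₂ := (eventLE_loop d body w e' e).1 h₂
      rcases h₁ with h₁ | ⟨hp, h₁⟩
      · rcases h₂ with h₂ | ⟨hp, -⟩
        · exact (h₁.asymm h₂).elim
        · exact (Dir.Before.irrefl d _ (hp ▸ h₁)).elim
      · rcases h₂ with h₂ | ⟨-, h₂⟩
        · exact (Dir.Before.irrefl d _ (hp ▸ h₂)).elim
        · exact body.eventLE_antisymm w e e' (outer_eq_of_loop d body w h hp) h₁ h₂

theorem eventLE_trans (w : List D) : ∀ {k n : ℕ} (s : Stmt A k n) (e e' e'' : s.Event w),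
    s.EventLE w e e' → s.EventLE w e' e'' → s.EventLE w e e''
  | _, _, .skip, e, _, _, _, _ => Empty.elim e.1
  | _, _, .setTrue _, e, _, _, _, _ => Empty.elim e.1
  | _, _, .printConst _, _, _, _, _, _ => WordFormula.holds_top w _
  | _, _, .printLabel _, _, _, _, _, _ => WordFormula.holds_top w _
  | _, _, .ite e s₁ s₂, ⟨t, q⟩, ⟨t', q'⟩, ⟨t'', q''⟩, h, h' => by
      rcases t with t | t <;> rcases t'' with t'' | t'' <;> rcases t' with t' | t'
      · exact s₁.eventLE_trans w ⟨t, q⟩ ⟨t', q'⟩ ⟨t'', q''⟩ h h'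
      · exact (WordFormula.not_holds_bot w _ h').elim
      · exact WordFormula.holds_top w _
      · exact WordFormula.holds_top w _
      · exact (WordFormula.not_holds_bot w _ h).elim
      · exact (WordFormula.not_holds_bot w _ h').elim
      · exact (WordFormula.not_holds_bot w _ h).elim
      · exact s₂.eventLE_trans w ⟨t, q⟩ ⟨t', q'⟩ ⟨t'', q''⟩ h h'
  | _, _, .seq s₁ s₂, ⟨t, q⟩, ⟨t', q'⟩, ⟨t'', q''⟩, h, h' => by
      rcases t with t | t <;> rcases t'' with t'' | t'' <;> rcases t' with t' | t'
      · exact s₁.eventLE_trans w ⟨t, q⟩ ⟨t', q'⟩ ⟨t'', q''⟩ h h'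
      · exact (WordFormula.not_holds_bot w _ h').elim
      · exact WordFormula.holds_top w _
      · exact WordFormula.holds_top w _
      · exact (WordFormula.not_holds_bot w _ h).elim
      · exact (WordFormula.not_holds_bot w _ h').elim
      · exact (WordFormula.not_holds_bot w _ h).elim
      · exact s₂.eventLE_trans w ⟨t, q⟩ ⟨t', q'⟩ ⟨t'', q''⟩ h h'
  | _, _, .loop d m body, e, e', e'', h, h' => by
      replace h := (eventLE_loop d body w e e').1 h
      replace h' := (eventLE_loop d body w e' e'').1 h'
      refine (eventLE_loop d body w e e'').2 ?_
      rcases h with h | ⟨hp, h⟩ <;> rcases h' with h' | ⟨hp', h'⟩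
      · exact Or.inl (h.trans h')
      · exact Or.inl (hp' ▸ h)
      · exact Or.inl (hp ▸ h')
      · exact Or.inr ⟨hp.trans hp', body.eventLE_trans w e e' e'' h h'⟩

theorem eventLE_refl {k n : ℕ} (s : Stmt A k n) (w : List D) (e : s.Event w) :
    s.EventLE w e e :=
  (s.eventLE_total w e e rfl).elim id id

end Stmt

/-! ### Lists of events of two-part statements -/

section Sums

variable {α β : Type*} {F : α ⊕ β → Type*}

theorem mk_inl_mem_map_inl {l : List (Σ a, F (Sum.inl a))} {a : α} {x : F (Sum.inl a)} :
    (⟨Sum.inl a, x⟩ : Σ c, F c) ∈ l.map (fun y => ⟨Sum.inl y.1, y.2⟩) ↔ ⟨a, x⟩ ∈ l := by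
  rw [List.mem_map]
  refine ⟨?_, fun h => ⟨_, h, rfl⟩⟩
  rintro ⟨⟨a', x'⟩, h, he⟩
  cases he
  exact h

theorem mk_inr_mem_map_inr {l : List (Σ b, F (Sum.inr b))} {b : β} {x : F (Sum.inr b)} :
    (⟨Sum.inr b, x⟩ : Σ c, F c) ∈ l.map (fun y => ⟨Sum.inr y.1, y.2⟩) ↔ ⟨b, x⟩ ∈ l := by
  rw [List.mem_map]
  refine ⟨?_, fun h => ⟨_, h, rfl⟩⟩
  rintro ⟨⟨a', x'⟩, h, he⟩
  cases he
  exact h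

theorem mk_inl_notMem_map_inr {l : List (Σ b, F (Sum.inr b))} {a : α} {x : F (Sum.inl a)} :
    (⟨Sum.inl a, x⟩ : Σ c, F c) ∉ l.map (fun y => ⟨Sum.inr y.1, y.2⟩) := by
  rw [List.mem_map]
  rintro ⟨⟨a', x'⟩, h, he⟩
  cases he

theorem mk_inr_notMem_map_inl {l : List (Σ a, F (Sum.inl a))} {b : β} {x : F (Sum.inr b)} :
    (⟨Sum.inr b, x⟩ : Σ c, F c) ∉ l.map (fun y => ⟨Sum.inl y.1, y.2⟩) := by
  rw [List.mem_map]
  rintro ⟨⟨a', x'⟩, h, he⟩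
  cases he

end Sums

theorem exists_map_val_eq {α : Type*} {p : α → Prop} (l : List α) (h : ∀ a ∈ l, p a) :
    ∃ L : List {a // p a}, L.map Subtype.val = l :=
  ⟨l.attachWith p h, List.attachWith_map_subtype_val h⟩

/-! ### Traces: printed word, membership and order -/

namespace Stmt

variable {D : Type u} {A : Finset D}

/-- The values of the position variables in the scope of a print statement of `s₁` or `s₂`. -/
abbrev SumVals {k n : ℕ} (s₁ s₂ : Stmt A k n) (w : List D) (c : s₁.Print ⊕ s₂.Print) : Type :=
  Fin (Sum.elim s₁.ar s₂.ar c) → Pos w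

variable [DecidableEq D]

/-- The print events of an execution, in the order in which they occur. -/
def trace (w : List D) : {k n : ℕ} → (s : Stmt A k n) → (Fin k → Pos w) → (Fin n → Bool) →
    List (s.Event w)
  | _, _, .skip, _, _ => []
  | _, _, .setTrue _, _, _ => []
  | _, _, .printConst _, ρ, _ => [⟨(), ρ⟩]
  | _, _, .printLabel _, ρ, _ => [⟨(), ρ⟩]
  | _, _, .ite e s₁ s₂, ρ, σ =>
      if e.eval w ρ σ then (s₁.trace w ρ σ).map fun x => ⟨Sum.inl x.1, x.2⟩
      else (s₂.trace w ρ σ).map fun x => ⟨Sum.inr x.1, x.2⟩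
  | _, _, .seq s₁ s₂, ρ, σ =>
      ((s₁.trace w ρ σ).map fun x => ⟨Sum.inl x.1, x.2⟩) ++
        (s₂.trace w ρ (s₁.exec w ρ σ).1).map fun x => ⟨Sum.inr x.1, x.2⟩
  | _, _, .loop d _ body, ρ, σ =>
      (d.positions w).flatMap fun p => body.trace w (push ρ p)
        (Fin.append (stateBefore d w (body.loopStep w ρ) σ p) fun _ => false)

theorem exec_eq_map_trace (w : List D) : ∀ {k n : ℕ} (s : Stmt A k n) (ρ : Fin k → Pos w)
    (σ : Fin n → Bool), (s.exec w ρ σ).2 = (s.trace w ρ σ).map (s.letter w)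
  | _, _, .skip, _, _ => rfl
  | _, _, .setTrue _, _, _ => rfl
  | _, _, .printConst _, _, _ => rfl
  | _, _, .printLabel _, _, _ => rfl
  | _, _, .ite e s₁ s₂, ρ, σ => by
      rw [exec, trace]
      split_ifs
      · rw [s₁.exec_eq_map_trace w, List.map_map]
        rfl
      · rw [s₂.exec_eq_map_trace w, List.map_map]
        rfl
  | _, _, .seq s₁ s₂, ρ, σ => by
      rw [exec, trace]
      refine Eq.trans ?_ List.map_append.symm
      rw [List.map_map, List.map_map]
      exact congrArg₂ _ (s₁.exec_eq_map_trace w ρ σ) (s₂.exec_eq_map_trace w ρ _)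
  | _, _, .loop d m body, ρ, σ => by
      rw [exec_loop]
      refine (List.flatMap_congr fun p _ => body.exec_eq_map_trace w _ _).trans ?_
      rw [trace]
      exact List.map_flatMap.symm

/-- The iteration at `p` starts in the state left by the iterations before `p`, with its local
variables false. The outputs on the right are fixed to false since `after` substitutes constants for
the outputs of its second formula. -/
theorem rel_domFormula_loop {k n m : ℕ} (d : Dir) (body : Stmt A (k + 1) (n + m)) (w : List D)
    (ρ : Fin k → Pos w) (σ τ : Fin n → Bool) (e : body.Event w) (p : Pos w)
    (h : body.outer e = push ρ p) :
    PFormula.Rel (domFormula (Stmt.loop (n := n) d m body) e.1) w e.2 σ τ ↔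
      ∃ μ : Fin m → Bool, PFormula.Rel (body.domFormula e.1) w e.2
        (Fin.append (stateBefore d w (body.loopStep w ρ) σ p) fun _ => false)
        (Fin.append (fun _ => false) μ) := by
  have hd : PFormula.Describes ((PFormula.iterBefore d (PFormula.closeLocals body.toFormula)).rename
      (Fin.castLE (body.le_ar e.1))) w e.2
      (fun σ => stateBefore d w (body.loopStep w ρ) σ p) := by
    refine PFormula.Describes.rename ?_
    have h' : e.2 ∘ Fin.castLE (body.le_ar e.1) = push ρ p := h
    rw [h']
    exact PFormula.iterBefore_describes d (F := body.loopStep w ρ)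
        (fun p => PFormula.closeLocals_describes (body.toFormula_describes w (push ρ p)))
        (body.loopStep_mono w ρ) p
  exact (PFormula.after_rel _ hd σ τ).trans
    (PFormula.closeLocals_rel (body.domFormula e.1) w e.2 _ _)

/-- Each domain formula describes the state in which its print statement's enclosing piece of code
starts, so reachability follows by induction on the program. The output values `τ` are arbitrary
because domain formulas constrain no outputs; this freedom lets every inductive call choose
convenient ones. -/
theorem mem_trace (w : List D) : ∀ {k n : ℕ} (s : Stmt A k n) (ρ : Fin k → Pos w)
    (σ τ : Fin n → Bool) (e : s.Event w), e ∈ s.trace w ρ σ ↔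
      s.outer e = ρ ∧ PFormula.Rel (s.domFormula e.1) w e.2 σ τ
  | _, _, .skip, _, _, _, e => Empty.elim e.1
  | _, _, .setTrue _, _, _, _, e => Empty.elim e.1
  | _, _, .printConst _, ρ, σ, τ, ⟨_, q⟩ => by
      refine List.mem_singleton.trans ⟨fun h => ?_, fun h => Sigma.ext rfl (heq_of_eq h.1)⟩
      cases h
      exact ⟨rfl, BFO.top_holds _ _ _ _⟩
  | _, _, .printLabel _, ρ, σ, τ, ⟨_, q⟩ => by
      refine List.mem_singleton.trans ⟨fun h => ?_, fun h => Sigma.ext rfl (heq_of_eq h.1)⟩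
      cases h
      exact ⟨rfl, BFO.top_holds _ _ _ _⟩
  | _, _, .ite e s₁ s₂, ρ, σ, τ, ⟨t, q⟩ => by
      rw [trace]
      rcases t with t | t
      · have h₁ : PFormula.Rel (domFormula (.ite e s₁ s₂) (Sum.inl t)) w q σ τ ↔
            e.eval w (s₁.outer ⟨t, q⟩) σ = true ∧ PFormula.Rel (s₁.domFormula t) w q σ τ :=
          and_congr ((PFormula.rename_rel _ _ _ _ _ _).trans (e.toFormula_rel _ _ _ _)) Iff.rfl
        have h₂ := s₁.mem_trace w ρ σ τ ⟨t, q⟩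
        -- The renamed condition is evaluated at the positions carried by the event; these are the
        -- current positions `ρ` only under the first conjunct, so the two conjuncts are treated
        -- together.
        refine Iff.trans ?_ (and_congr (Iff.rfl : s₁.outer ⟨t, q⟩ = ρ ↔ _) h₁.symm)
        split_ifs with h
        · refine (mk_inl_mem_map_inl (F := SumVals s₁ s₂ w)
          (l := s₁.trace w ρ σ)).trans (h₂.trans ?_)
          refine and_congr_right fun ho => ?_
          rw [ho]
          exact (and_iff_right h).symm
        · refine iff_of_false (mk_inl_notMem_map_inr (F := SumVals s₁ s₂ w)
          (l := s₂.trace w ρ σ)) fun h' => h ?_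
          rw [← h'.1]
          exact h'.2.1
      · have h₁ : PFormula.Rel (domFormula (.ite e s₁ s₂) (Sum.inr t)) w q σ τ ↔
            (¬ e.eval w (s₂.outer ⟨t, q⟩) σ = true) ∧ PFormula.Rel (s₂.domFormula t) w q σ τ :=
          and_congr (not_congr ((PFormula.rename_rel _ _ _ _ _ _).trans (e.toFormula_rel _ _ _ _)))
            Iff.rfl
        have h₂ := s₂.mem_trace w ρ σ τ ⟨t, q⟩
        refine Iff.trans ?_ (and_congr (Iff.rfl : s₂.outer ⟨t, q⟩ = ρ ↔ _) h₁.symm)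
        split_ifs with h
        · refine iff_of_false (mk_inr_notMem_map_inl (F := SumVals s₁ s₂ w)
          (l := s₁.trace w ρ σ)) fun h' => h'.2.1 ?_
          rw [h'.1]
          exact h
        · refine (mk_inr_mem_map_inr (F := SumVals s₁ s₂ w)
          (l := s₂.trace w ρ σ)).trans (h₂.trans ?_)
          refine and_congr_right fun ho => ?_
          rw [ho]
          exact (and_iff_right h).symm
  | _, _, .seq s₁ s₂, ρ, σ, τ, ⟨t, q⟩ => by
      rw [trace]
      refine List.mem_append.trans ?_
      rcases t with t | t
      · refine (or_iff_left
          (mk_inl_notMem_map_inr (F := SumVals s₁ s₂ w)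
          (l := s₂.trace w ρ (s₁.exec w ρ σ).1))).trans ?_
        exact (mk_inl_mem_map_inl (F := SumVals s₁ s₂ w)
          (l := s₁.trace w ρ σ)).trans (s₁.mem_trace w ρ σ τ ⟨t, q⟩)
      · refine (or_iff_right (mk_inr_notMem_map_inl (F := SumVals s₁ s₂ w)
          (l := s₁.trace w ρ σ))).trans ?_
        refine (mk_inr_mem_map_inr (F := SumVals s₁ s₂ w)
          (l := s₂.trace w ρ (s₁.exec w ρ σ).1)).trans ?_
        refine (s₂.mem_trace w ρ _ (fun _ => false) ⟨t, q⟩).trans ?_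
        refine and_congr_right fun ho => ?_
        have hd : PFormula.Describes (s₁.toFormula.rename (Fin.castLE (s₂.le_ar t))) w q
            (fun σ => (s₁.exec w ρ σ).1) := by
          refine PFormula.Describes.rename ?_
          subst ho
          exact s₁.toFormula_describes w _
        exact (PFormula.after_rel (s₂.domFormula t) hd σ τ).symm
  | _, _, .loop d m body, ρ, σ, τ, e => by
      rw [trace]
      refine List.mem_flatMap.trans ⟨?_, ?_⟩
      · rintro ⟨p, -, he⟩
        have h := (body.mem_trace w _ _ (Fin.append (fun _ => false) fun _ => false) e).1 he
        refine ⟨?_, (rel_domFormula_loop d body w ρ σ τ e p h.1).2 ⟨_, h.2⟩⟩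
        refine (outer_loop d body w e).trans ?_
        rw [h.1, push_comp_castSucc]
      · rintro ⟨ho, hr⟩
        -- The iteration that contains the event is read off from the event itself: it is the value
        -- of the loop variable.
        have hb := (outer_body d body w e).trans (congrArg (push · _) ho)
        obtain ⟨μ, hμ⟩ := (rel_domFormula_loop d body w ρ σ τ e _ hb).1 hr
        exact ⟨_, d.mem_positions w _, (body.mem_trace w _ _ _ e).2 ⟨hb, hμ⟩⟩

/-- Events of one iteration share the loop position and are compared inside the body; events of
different iterations are separated by their loop positions. The strict form also excludes
repetitions in the trace. -/
theorem pairwise_trace (w : List D) : ∀ {k n : ℕ} (s : Stmt A k n) (ρ : Fin k → Pos w)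
    (σ : Fin n → Bool), (s.trace w ρ σ).Pairwise fun e e' => s.EventLE w e e' ∧ ¬ s.EventLE w e' e
  | _, _, .skip, _, _ => List.Pairwise.nil
  | _, _, .setTrue _, _, _ => List.Pairwise.nil
  | _, _, .printConst _, _, _ => List.pairwise_singleton _ _
  | _, _, .printLabel _, _, _ => List.pairwise_singleton _ _
  | _, _, .ite e s₁ s₂, ρ, σ => by
      rw [trace]
      split_ifs
      · exact List.pairwise_map.2 (s₁.pairwise_trace w ρ σ)
      · exact List.pairwise_map.2 (s₂.pairwise_trace w ρ σ)
  | _, _, .seq s₁ s₂, ρ, σ => by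
      rw [trace]
      refine List.pairwise_append.2 ⟨List.pairwise_map.2 (s₁.pairwise_trace w ρ σ),
        List.pairwise_map.2 (s₂.pairwise_trace w ρ _), fun x hx y hy => ?_⟩
      obtain ⟨x, -, rfl⟩ := List.mem_map.1 hx
      obtain ⟨y, -, rfl⟩ := List.mem_map.1 hy
      exact ⟨WordFormula.holds_top w _, WordFormula.not_holds_bot w _⟩
  | _, _, .loop d m body, ρ, σ => by
      rw [trace]
      refine List.pairwise_flatMap.2 ⟨fun p _ => ?_, ?_⟩
      · refine (body.pairwise_trace w _ _).imp_of_mem fun {e e'} he he' h => ?_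
        have hp := (((body.mem_trace w _ _ (fun _ => false) e).1 he).1.trans
          ((body.mem_trace w _ _ (fun _ => false) e').1 he').1.symm)
        have hl : body.loopPos w e = body.loopPos w e' := congrFun hp (Fin.last _)
        refine ⟨(eventLE_loop d body w e e').2 (Or.inr ⟨hl, h.1⟩), fun h' => ?_⟩
        rcases (eventLE_loop d body w e' e).1 h' with h' | h'
        · exact Dir.Before.irrefl d _ (hl ▸ h')
        · exact h.2 h'.2
      · refine (d.pairwise_positions w).imp fun {p p'} hpp e he e' he' => ?_
        have hl : body.loopPos w e = p :=
          (congrFun ((body.mem_trace w _ _ (fun _ => false) e).1 he).1 (Fin.last _)).trans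
            (push_last _ _)
        have hl' : body.loopPos w e' = p' :=
          (congrFun ((body.mem_trace w _ _ (fun _ => false) e').1 he').1 (Fin.last _)).trans
            (push_last _ _)
        refine ⟨(eventLE_loop d body w e e').2 (Or.inl (by rwa [hl, hl'])), fun h' => ?_⟩
        rcases (eventLE_loop d body w e' e).1 h' with h' | h'
        · rw [hl, hl'] at h'
          exact hpp.asymm h'
        · rw [hl, hl'] at h'
          exact Dir.Before.irrefl d _ (h'.1 ▸ hpp)

end Stmt

theorem Interpretation.letter_eq_readLetter {D : Type u} (I : Interpretation D) (w : List D)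
    (e : I.Elem w) : I.letter w e = Stmt.readLetter w e.1.2 (I.out e.1.1) := by
  unfold Interpretation.letter
  cases I.out e.1.1 <;> rfl

/-! ### Correctness of the compilation -/

namespace Program

variable {D : Type u} (P : Program D) (w : List D)

/-- The elements of the compilation are print events. -/
def toEvent (e : P.compile.Elem w) : P.body.Event w := e.1

theorem letter_compile (e : P.compile.Elem w) :
    P.compile.letter w e = P.body.letter w (P.toEvent w e) :=
  P.compile.letter_eq_readLetter w e

/-- At the top level there are no outer position variables, so the side condition on outer positions
in totality and antisymmetry is trivial. -/
theorem isLinearOrder_compile : IsLinearOrder (P.compile.Elem w) (P.compile.le w) where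
  refl e := P.body.eventLE_refl w e.1
  trans e e' e'' h h' := P.body.eventLE_trans w e.1 e'.1 e''.1 h h'
  antisymm e e' h h' := Subtype.ext
    (P.body.eventLE_antisymm w e.1 e'.1 (Subsingleton.elim _ _) h h')
  total e e' := P.body.eventLE_total w e.1 e'.1 (Subsingleton.elim _ _)

variable [DecidableEq D]

theorem mem_trace_body (e : P.body.Event w) :
    e ∈ P.body.trace w Fin.elim0 (fun _ => false) ↔ (P.compile.dom e.1).Holds w e.2 := by
  refine (P.body.mem_trace w _ _ (fun _ => false) e).trans
    ((and_iff_right (Subsingleton.elim _ _)).trans ?_)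
  refine Iff.trans ?_ (BFO.toWord_holds w (fun _ => false) _ e.2 Fin.elim0).symm
  rw [PFormula.rel_iff_holds]
  have : (ioVal (fun _ => false) fun _ => false : PVar P.n → Bool) = fun _ => false := by
    funext v; cases v <;> rfl
  rw [this]
  exact Iff.rfl

/-- Both the merge sort of all elements and the trace are sorted enumerations without repetition of
the same finite set, and antisymmetry leaves only one such list. -/
theorem eval_compile : P.compile.eval w = P.eval w := by
  classical
  have hlin := P.isLinearOrder_compile w
  rw [Interpretation.eval, if_pos hlin, Program.eval, Stmt.exec_eq_map_trace]
  -- Trace events satisfy their domain formulas, so the trace lifts to a list in the subtype of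
  -- elements, where it can be compared with the sorted list.
  obtain ⟨L, hL⟩ : ∃ L : List (P.compile.Elem w),
      L.map (P.toEvent w) = P.body.trace w Fin.elim0 fun _ => false :=
    exists_map_val_eq _ fun e he => (P.mem_trace_body w e).1 he
  have hpair : L.Pairwise fun e e' => P.compile.le w e e' ∧ ¬ P.compile.le w e' e := by
    have h := P.body.pairwise_trace w Fin.elim0 fun _ => false
    rw [← hL, List.pairwise_map] at h
    exact h
  have hmem : ∀ e, e ∈ L := by
    intro e
    have h : P.toEvent w e ∈ _ := (P.mem_trace_body w e.1).2 e.2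
    rw [← hL, List.mem_map] at h
    obtain ⟨e', he', h⟩ := h
    have : e' = e := Subtype.ext h
    exact this ▸ he'
  have hnodup : L.Nodup := hpair.imp fun {e e'} h (he : e = e') => by
    subst he
    exact h.2 h.1
  have hperm : (Finset.univ.toList.mergeSort fun a b => decide (P.compile.le w a b)).Perm L :=
    (List.mergeSort_perm _ _).trans
      ((List.perm_ext_iff_of_nodup (Finset.nodup_toList _) hnodup).2 fun e => by simp [hmem])
  have heq : (Finset.univ.toList.mergeSort fun a b => decide (P.compile.le w a b)) = L := by
    refine List.Perm.eq_of_pairwise (le := P.compile.le w) (fun a b _ _ => hlin.antisymm a b) ?_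
      (hpair.imp fun h => h.1) hperm
    refine (List.pairwise_mergeSort (fun a b c hab hbc => ?_) (fun a b => ?_) _).imp
      fun h => of_decide_eq_true h
    · exact decide_eq_true (hlin.trans a b c (of_decide_eq_true hab) (of_decide_eq_true hbc))
    · simpa using hlin.total a b
  rw [heq, ← hL, List.map_map]
  exact List.map_congr_left fun e _ => P.letter_compile w e

end Program

end ForProg

theorem mainTheorem3 {D : Type*} [DecidableEq D] :
    -- every program is equivalent to its compilation, and the order formulas are quantifier-free
    (∀ P : Program D,
      (∀ w : List D, IsLinearOrder (P.compile.Elem w) (P.compile.le w) ∧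
        P.compile.eval w = P.eval w) ∧
      ∀ t t' : P.compile.Tag, (P.compile.ord t t').IsQF) ∧
    -- program formulas of statements
    (∀ (A : Finset D) (k n : ℕ) (s : Stmt A k n) (w : List D) (ρ : Fin k → Pos w),
      PFormula.Describes s.toFormula w ρ (fun σ => (s.exec w ρ σ).1)) ∧
    -- branching
    (∀ (A : Finset D) (k n : ℕ) (φ Φ₁ Φ₂ : PFormula A k n), φ.outVars = ∅ →
      ∀ (w : List D) (ρ : Fin k → Pos w) (c : (Fin n → Bool) → Bool)
        (F₁ F₂ : (Fin n → Bool) → (Fin n → Bool)),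
        (∀ σ τ, PFormula.Rel φ w ρ σ τ ↔ c σ = true) →
        PFormula.Describes Φ₁ w ρ F₁ → PFormula.Describes Φ₂ w ρ F₂ →
        PFormula.Describes (PFormula.branch φ Φ₁ Φ₂) w ρ
          (fun σ => if c σ = true then F₁ σ else F₂ σ)) ∧
    -- sequencing
    (∀ (A : Finset D) (k n : ℕ) (Φ₁ Φ₂ : PFormula A k n),
      (∀ (w : List D) (ρ : Fin k → Pos w) (F₁ F₂ : (Fin n → Bool) → (Fin n → Bool)),
        PFormula.Describes Φ₁ w ρ F₁ → PFormula.Describes Φ₂ w ρ F₂ →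
        PFormula.Describes (PFormula.comp Φ₁ Φ₂) w ρ (fun σ => F₂ (F₁ σ))) ∧
      (PFormula.comp Φ₁ Φ₂).qr ≤
        max Φ₁.qr Φ₂.qr + (Φ₁.outVars ∩ (Φ₂.inVars ∪ Φ₂.outVars)).card) ∧
    -- accelerated iteration
    (∀ (A : Finset D) (k n : ℕ) (d : Dir) (Φ : PFormula A (k + 1) n),
      (∀ (w : List D) (ρ : Fin k → Pos w) (F : Pos w → (Fin n → Bool) → (Fin n → Bool)),
        (∀ p, PFormula.Describes Φ w (push ρ p) (F p)) →
        (∀ p σ b, σ b = true → F p σ b = true) →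
        PFormula.Describes (PFormula.iter d Φ) w ρ
          (fun σ => (d.positions w).foldl (fun σ' p => F p σ') σ)) ∧
      (PFormula.iter d Φ).qr ≤ Φ.qr + Φ.outVars.card ^ 2 + Φ.outVars.card + 1) := by
  exact ⟨fun P => ⟨fun w => ⟨P.isLinearOrder_compile w, P.eval_compile w⟩,
      fun t t' => P.body.isQF_ordFormula t t'⟩,
    fun _ _ _ s w ρ => s.toFormula_describes w ρ,
    fun _ _ _ _ _ _ hφ _ _ _ _ _ hc h₁ h₂ => PFormula.branch_describes hφ hc h₁ h₂,
    fun _ _ _ Φ₁ Φ₂ => ⟨fun _ _ _ _ h₁ h₂ => PFormula.comp_describes h₁ h₂,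
      PFormula.qr_comp_le Φ₁ Φ₂⟩,
    fun _ _ _ d Φ => ⟨fun _ _ _ hF hmono => PFormula.iter_describes d hF hmono,
      PFormula.qr_iter_le d Φ⟩⟩
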